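/- A tree means a rooted planar tree in which every vertex has finite degree and the root has degree $1$; trees are considered up to isomorphism, may be finite or infinite, and form the set $\mathcal T$. For $T\in\mathcal T$ let $|T|$ be its number of edges, $D_r(T)$ the set of vertices at graph distance $r$ from the root (ordered from left to right), $B_r(T)$ the subtree spanned by the vertices at distance at most $r$ from the root, and $h(T)$ its height, i.e. the maximal distance of a vertex from the root, with $h(T)=\infty$ if $T$ is infinite. Equip $\mathcal T$ with the metric $\mathrm{dist}(T,T')=\inf\{1/r : r\in\mathbb N,\ r\ge 1,\ B_r(T)=B_r(T')\}$ and its Borel $\sigma$-algebra, and let $\mathcal B_a(T_0)=\{T:\mathrm{dist}(T,T_0)\le a\}$. Let $\omega_T$ be the longest (possibly infinite) path in $T$ starting at the root whose $k$-th vertex is the left-most vertex of $D_k(T)$ for every finite $k$ not exceeding its length $|\omega_T|$. The tree $T$ is one-sided if $|\omega_T|=h(T)$. Let $\Omega_N$, $\Omega_{\rm fin}$ and $\Omega_\infty$ be the sets of one-sided trees with $|T|=N$, of finite one-sided trees and of infinite one-sided trees. For $\mu\in\mathbb R$ and $N\ge 1$ let $\tau_N^{(\mu)}$ be the probability measure on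 $\mathcal T$ concentrated on $\Omega_N$ with $$\tau_N^{(\mu)}(\{T\})=\frac{e^{-\mu h(T)}}{W_N^{(\mu)}}\quad (T\in\Omega_N),\qquad W_N^{(\mu)}=\sum_{m\ge 1}e^{-\mu m}\,\bigl|\{T\in\Omega_N: h(T)=m\}\bigr| .$$ Let $X(g)=\sum_{T}g^{|T|}$, the sum running over all finite trees $T\in\mathcal T$, and for $\mu<\mu_0:=-\ln 2$ put $g_c=e^{\mu}(1-e^{\mu})$; the series $X(g_c)$ converges. **Theorem.** For each $\mu<\mu_0$ the sequence $(\tau_N^{(\mu)})_{N\ge1}$ converges weakly to a Borel probability measure $\tau^{(\mu)}$ on $\mathcal T$ that is supported on $\Omega_\infty$, i.e. $\tau^{(\mu)}(\mathcal T\setminus\Omega_\infty)=0$, and satisfies $$\tau^{(\mu)}\bigl(\mathcal B_{1/r}(T_0)\bigr)=e^{-\mu(r-1)}\,g_c^{\,|T_0|-K}\,X(g_c)^{K-1}$$ for every $T_0\in\Omega_{\rm fin}$, where $r=h(T_0)$ and $K=|D_r(T_0)|$. Moreover $\tau^{(\mu)}$ is characterized by this formula: it is the only Borel probability measure on $\mathcal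 T$ for which it holds for all $T_0\in\Omega_{\rm fin}$. -/

import Mathlib

open Filter Topology MeasureTheory
open scoped BoundedContinuousFunction ENNReal

/-- A locally finite rooted planar tree whose root has degree one, in Ulam-Harris coding.
A vertex is the word `[i₁, …, i_k]` recording the path from the root `[]` to it: `v ++ [i]` is
the `i`-th child of `v`, counted from `0` and from left to right.  The coding is canonical: two
planar rooted trees are isomorphic exactly when their codes are equal. -/
@[ext]
structure PlaneTree where
  verts : Set (List ℕ)
  root_mem : [] ∈ verts
  parent_mem : ∀ (v : List ℕ) (i : ℕ), v ++ [i] ∈ verts → v ∈ verts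
  sibling_mem : ∀ (v : List ℕ) (i j : ℕ), v ++ [i] ∈ verts → j ≤ i → v ++ [j] ∈ verts
  finite_children : ∀ v : List ℕ, {i : ℕ | v ++ [i] ∈ verts}.Finite
  root_degree_one : ∀ i : ℕ, [i] ∈ verts ↔ i = 0

namespace PlaneTree

/-- The edges, as pairs (parent, child). -/
def edges (T : PlaneTree) : Set (List ℕ × List ℕ) :=
  {e | e.2 ∈ T.verts ∧ ∃ i : ℕ, e.2 = e.1 ++ [i]}

/-- The size `|T|`: the number of edges. -/
noncomputable def size (T : PlaneTree) : ℕ∞ := T.edges.encard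

/-- `D_r(T)`: the set of vertices at graph distance `r` from the root. Its left-to-right order is
the lexicographic order of words. -/
def level (T : PlaneTree) (r : ℕ) : Set (List ℕ) := {v | v ∈ T.verts ∧ v.length = r}

/-- `B_r(T)`, for `r ≥ 1`: the subtree spanned by the vertices at distance at most `r` from the
root, given by its vertex set (which is again the code of that planar tree). -/
def rootBall (T : PlaneTree) (r : ℕ) : Set (List ℕ) := {v | v ∈ T.verts ∧ v.length ≤ r}

def IsFinite (T : PlaneTree) : Prop := T.verts.Finite

open Classical in
/-- The height: the maximal distance of a vertex from the root, and `∞` for an infinite tree. -/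
noncomputable def height (T : PlaneTree) : ℕ∞ :=
  if T.IsFinite then ⨆ v ∈ T.verts, (v.length : ℕ∞) else ⊤

/-- `p 0, …, p n` is a simple path from the root (each vertex is a child of the preceding one)
such that `p k` is the left-most vertex of `D_k(T)` for every `k ≤ n`. -/
def IsLeftmostPath (T : PlaneTree) (n : ℕ) (p : ℕ → List ℕ) : Prop :=
  (∀ k < n, ∃ i : ℕ, p (k + 1) = p k ++ [i]) ∧ ∀ k ≤ n, IsLeast (T.level k) (p k)

/-- `|ω_T|`: the length, possibly infinite, of the maximal left-most path from the root. -/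
noncomputable def leftmostLength (T : PlaneTree) : ℕ∞ :=
  ⨆ n ∈ {n : ℕ | ∃ p : ℕ → List ℕ, T.IsLeftmostPath n p}, (n : ℕ∞)

def IsOneSided (T : PlaneTree) : Prop := T.leftmostLength = T.height

/-! ### The local metric -/

theorem rootBall_mono {T T' : PlaneTree} {r s : ℕ} (hrs : r ≤ s)
    (h : T.rootBall s = T'.rootBall s) : T.rootBall r = T'.rootBall r := by
  ext v
  have hv := Set.ext_iff.mp h v
  simp only [rootBall, Set.mem_ofPred_eq] at hv ⊢
  constructor <;> rintro ⟨h1, h2⟩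
  · exact ⟨(hv.mp ⟨h1, h2.trans hrs⟩).1, h2⟩
  · exact ⟨(hv.mpr ⟨h1, h2.trans hrs⟩).1, h2⟩

theorem rootBall_one (T T' : PlaneTree) : T.rootBall 1 = T'.rootBall 1 := by
  ext v
  simp only [rootBall, Set.mem_ofPred_eq]
  match v with
  | [] => simp [T.root_mem, T'.root_mem]
  | [i] => simp [T.root_degree_one, T'.root_degree_one]
  | _ :: _ :: _ => simp

/-- The values `1/r`, for `r ≥ 1` such that `B_r(T) = B_r(T')`. -/
def agreeRadii (T T' : PlaneTree) : Set ℝ :=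
  {x | ∃ r : ℕ, 1 ≤ r ∧ T.rootBall r = T'.rootBall r ∧ x = 1 / (r : ℝ)}

theorem agreeRadii_nonempty (T T' : PlaneTree) : (agreeRadii T T').Nonempty :=
  ⟨1 / ((1 : ℕ) : ℝ), 1, le_rfl, rootBall_one T T', rfl⟩

theorem agreeRadii_nonneg {T T' : PlaneTree} {x : ℝ} (hx : x ∈ agreeRadii T T') : 0 ≤ x := by
  obtain ⟨r, -, -, rfl⟩ := hx
  positivity

theorem agreeRadii_bddBelow (T T' : PlaneTree) : BddBelow (agreeRadii T T') :=
  ⟨0, fun _ hx => agreeRadii_nonneg hx⟩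

/-- `dist(T, T') = inf {1/r | r ≥ 1, B_r(T) = B_r(T')}`. -/
noncomputable instance : Dist PlaneTree := ⟨fun T T' => sInf (agreeRadii T T')⟩

theorem dist_def (T T' : PlaneTree) : dist T T' = sInf (agreeRadii T T') := rfl

theorem dist_nonneg_aux (T T' : PlaneTree) : 0 ≤ dist T T' :=
  le_csInf (agreeRadii_nonempty T T') fun _ hx => agreeRadii_nonneg hx

theorem dist_self_aux (T : PlaneTree) : dist T T = 0 := by
  refine le_antisymm (le_of_forall_pos_le_add fun ε hε => ?_) (dist_nonneg_aux T T)
  obtain ⟨n, hn⟩ := exists_nat_one_div_lt hε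
  have h : dist T T ≤ 1 / ((n + 1 : ℕ) : ℝ) :=
    csInf_le (agreeRadii_bddBelow T T) ⟨n + 1, by omega, rfl, rfl⟩
  push_cast at h
  linarith

theorem dist_comm_aux (T T' : PlaneTree) : dist T T' = dist T' T := by
  have : agreeRadii T T' = agreeRadii T' T := by
    ext x
    exact ⟨fun ⟨r, h1, h2, h3⟩ => ⟨r, h1, h2.symm, h3⟩,
      fun ⟨r, h1, h2, h3⟩ => ⟨r, h1, h2.symm, h3⟩⟩
  rw [dist_def, dist_def, this]

theorem dist_max_aux (T T' T'' : PlaneTree) :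
    dist T T'' ≤ max (dist T T') (dist T' T'') := by
  refine le_of_forall_gt fun c hc => ?_
  obtain ⟨h1, h2⟩ := max_lt_iff.mp hc
  obtain ⟨_, ⟨r, hr1, hr, rfl⟩, hrc⟩ := exists_lt_of_csInf_lt (agreeRadii_nonempty _ _) h1
  obtain ⟨_, ⟨s, hs1, hs, rfl⟩, hsc⟩ := exists_lt_of_csInf_lt (agreeRadii_nonempty _ _) h2
  rcases le_total r s with h | h
  · exact lt_of_le_of_lt (csInf_le (agreeRadii_bddBelow _ _)
      ⟨r, hr1, hr.trans (rootBall_mono h hs), rfl⟩) hrc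
  · exact lt_of_le_of_lt (csInf_le (agreeRadii_bddBelow _ _)
      ⟨s, hs1, (rootBall_mono h hr).trans hs, rfl⟩) hsc

theorem eq_of_dist_eq_zero_aux {T T' : PlaneTree} (h : dist T T' = 0) : T = T' := by
  have key : ∀ n : ℕ, T.rootBall n = T'.rootBall n := by
    intro n
    have hpos : sInf (agreeRadii T T') < 1 / ((n : ℝ) + 1) := by
      rw [← dist_def, h]; positivity
    obtain ⟨_, ⟨r, hr1, hr, rfl⟩, hrc⟩ := exists_lt_of_csInf_lt (agreeRadii_nonempty _ _) hpos
    have hr0 : (0 : ℝ) < r := by exact_mod_cast hr1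
    have hlt : (n : ℝ) + 1 < r := (one_div_lt_one_div hr0 (by positivity)).mp hrc
    have : n + 1 < r := by exact_mod_cast hlt
    exact rootBall_mono (by omega) hr
  apply PlaneTree.ext
  ext v
  have hv := Set.ext_iff.mp (key v.length) v
  simpa [rootBall] using hv

noncomputable instance : MetricSpace PlaneTree where
  dist_self := dist_self_aux
  dist_comm := dist_comm_aux
  dist_triangle T T' T'' := (dist_max_aux T T' T'').trans
    (max_le_add_of_nonneg (dist_nonneg_aux _ _) (dist_nonneg_aux _ _))
  eq_of_dist_eq_zero := eq_of_dist_eq_zero_aux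

noncomputable instance : MeasurableSpace PlaneTree := borel PlaneTree

instance : BorelSpace PlaneTree := ⟨rfl⟩

/-! ### One-sided trees of fixed size and their distribution -/

/-- `Ω_N`: the one-sided trees of size `N`. -/
def oneSided (N : ℕ) : Set PlaneTree := {T | T.IsOneSided ∧ T.size = N}

/-- `Ω_∞`: the infinite one-sided trees. -/
def infiniteOneSided : Set PlaneTree := {T | T.IsOneSided ∧ ¬ T.IsFinite}

/-- `B_{m,N}`: the number of one-sided trees of height `m` and size `N`. -/
noncomputable def numOneSided (m N : ℕ) : ℕ∞ := {T | T ∈ oneSided N ∧ T.height = m}.encard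

/-- The partition function `W_N = ∑_{m ≥ 1} e^{-μ m} B_{m,N}`. -/
noncomputable def partitionFn (μ : ℝ) (N : ℕ) : ℝ≥0∞ :=
  ∑' m : ℕ, ENNReal.ofReal (Real.exp (-μ * ((m + 1 : ℕ) : ℝ))) * (numOneSided (m + 1) N : ℝ≥0∞)

/-- The measure `τ_N` on the space of trees that gives mass `e^{-μ h(T)} / W_N` to each
`T ∈ Ω_N`, and no mass to the complement of `Ω_N`. -/
noncomputable def finiteSizeMeasure (μ : ℝ) (N : ℕ) : Measure PlaneTree :=
  Measure.sum fun T : oneSided N =>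
    (ENNReal.ofReal (Real.exp (-μ * (T.1.height.toNat : ℝ))) / partitionFn μ N) •
      Measure.dirac T.1

/-- The generating function `X(g) = ∑ g^{|T|}`, summed over all finite trees. -/
noncomputable def treeGF (g : ℝ) : ℝ := ∑' T : {T : PlaneTree // T.IsFinite}, g ^ T.1.size.toNat

/-- `g_c(μ) = e^μ (1 - e^μ)`, for `μ ≤ -ln 2`. -/
noncomputable def criticalCoupling (μ : ℝ) : ℝ := Real.exp μ * (1 - Real.exp μ)

/-- `e^{-μ(r-1)} g_c^{n-K} X(g_c)^{K-1}`. -/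
noncomputable def ballWeight (μ : ℝ) (r n K : ℕ) : ℝ :=
  Real.exp (-μ * ((r : ℝ) - 1)) * criticalCoupling μ ^ ((n : ℤ) - (K : ℤ)) *
    treeGF (criticalCoupling μ) ^ ((K : ℤ) - 1)

/-- `τ(𝓑_{1/r}(T₀)) = e^{-μ(r-1)} g_c^{|T₀|-K} X(g_c)^{K-1}` for every finite one-sided tree `T₀`,
where `r = h(T₀)` and `K = |D_r(T₀)|`. -/
def HasBallWeights (μ : ℝ) (τ : Measure PlaneTree) : Prop :=
  ∀ (T₀ : PlaneTree) (r n K : ℕ), T₀.IsFinite → T₀.IsOneSided → T₀.height = r → T₀.size = n →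
    (T₀.level r).encard = K →
      τ (Metric.closedBall T₀ (1 / (r : ℝ))) = ENNReal.ofReal (ballWeight μ r n K)

end PlaneTree

/-! Put `p = e^μ` and `q = 1 - p`, so that `p < q` and `g_c = pq`. A one-sided tree of finite height
has the all-zero word as its spine. Suppose its ball of radius `r` is fixed, with `n` edges and `K =
k + 1` vertices at distance `r`. The left-most of these carries a one-sided tree of some height `s`,
and the other `k` carry arbitrary trees of height at most `s`. With `y_s` the generating function of
trees of height at most `s`, the extensions are therefore counted by `y_s ^ k · x ^ s · y_1 ⋯ y_s`,
and the weight `e^{-μh}` contributes `p^{-(r+s)}`.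

The analytic core is `exists_tendsto_ballCount`. Let `P_s = p^{-s} x^s y_1 ⋯ y_s` and `R_k = ∑ y_s^k
P_s`, and let `C = 1 + x C²` be the series of all finite trees. From `P_{s+1} = p⁻¹ x y_{s+1} P_s`
one gets `R_0 (1 - p⁻¹ x C) = 1 - D`, where `D` collects the errors `C - y_{s+1}`. The equation for
`C` gives `(1 - p⁻¹ x C)(1 - q⁻¹ x C) = 1 - x/(pq)`, so `R_0` times `1 - x/(pq)` is a series
converging absolutely at `pq`. This behaves like a simple pole, and the coefficients of `R_0`,
rescaled by `(pq)^N`, tend to a constant `L`. Positivity of `L` comes from `D(pq) < 1`. Since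
`y_s(pq) → C(pq) = 1/q` geometrically, `C^k R_0 - R_k` converges absolutely at `pq`, and the
coefficients of `R_k` tend to `L q^{-k}`. In the quotient by the partition function `L` cancels,
leaving the ball mass `p^{-(r-1)} (pq)^{n-1} q^{-(K-1)}`. This is the asserted formula because
`X(g_c) = p`.

Passing from balls to weak convergence needs tightness. The limiting ball masses at each radius sum
to one (`tsum_ballMass_eq_one`), so no mass escapes to large degrees, and
`isTightMeasureSet_finiteSizeMeasure` follows. Prokhorov's theorem supplies limit points. Cylinders
are clopen, so every limit point has the prescribed ball masses. These force an infinite spine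
almost surely and determine the measure on a generating π-system, hence the limit point is unique.
-/

namespace PlaneTree

open PowerSeries

/-! ### Generating functions of trees of bounded height and of one-sided trees -/

section Series

variable {R : Type*} [CommSemiring R]

/-- `∑ₖ yᵏ`, for a power series `y` without constant term. -/
noncomputable def geomSeries (y : PowerSeries R) : PowerSeries R :=
  PowerSeries.mk fun N => ∑ k ∈ Finset.range (N + 1), coeff N (y ^ k)

theorem coeff_pow_of_lt {y : PowerSeries R} (hy : constantCoeff y = 0) {N k : ℕ} (h : N < k) :
    coeff N (y ^ k) = 0 :=
  X_pow_dvd_iff.mp (pow_dvd_pow_of_dvd (X_dvd_iff.mpr hy) k) N h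

theorem coeff_geomSeries {y : PowerSeries R} (hy : constantCoeff y = 0) {N M : ℕ} (h : N < M) :
    coeff N (geomSeries y) = ∑ k ∈ Finset.range M, coeff N (y ^ k) := by
  rw [geomSeries, coeff_mk]
  refine Finset.sum_subset (Finset.range_mono h) fun k _ hk => coeff_pow_of_lt hy ?_
  simpa [Nat.lt_succ_iff] using hk

theorem geomSeries_eq {y : PowerSeries R} (hy : constantCoeff y = 0) :
    geomSeries y = 1 + y * geomSeries y := by
  ext N
  have h : coeff N (y * geomSeries y) = ∑ k ∈ Finset.range (N + 1), coeff N (y ^ (k + 1)) := by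
    simp_rw [pow_succ', coeff_mul]
    rw [Finset.sum_comm]
    refine Finset.sum_congr rfl fun ij hij => ?_
    rw [← Finset.mul_sum, coeff_geomSeries hy (M := N + 1)]
    have := Finset.HasAntidiagonal.mem_antidiagonal.mp hij
    omega
  rw [map_add, h, coeff_geomSeries hy (M := N + 2) (by omega), Finset.sum_range_succ' _ (N + 1),
    add_comm, pow_zero]

theorem map_geomSeries {S : Type*} [CommSemiring S] (φ : R →+* S) (y : PowerSeries R) :
    PowerSeries.map φ (geomSeries y) = geomSeries (PowerSeries.map φ y) := by
  ext N
  simp [geomSeries, ← map_pow]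

variable (R) in
/-- The generating function, by number of edges, of the planar trees of height at most `s` (with a
root of arbitrary degree). -/
noncomputable def heightSeries : ℕ → PowerSeries R
  | 0 => 1
  | s + 1 => geomSeries (X * heightSeries s)

-- A root with children carrying trees of height at most `s` gives `1 / (1 - x y_s)`. The equation
-- separates the case of no child from the removal of one child.
variable (R) in
theorem heightSeries_succ (s : ℕ) :
    heightSeries R (s + 1) = 1 + X * heightSeries R s * heightSeries R (s + 1) := by
  rw [heightSeries]
  exact geomSeries_eq (by simp)

theorem map_heightSeries {S : Type*} [CommSemiring S] (φ : R →+* S) (s : ℕ) :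
    PowerSeries.map φ (heightSeries R s) = heightSeries S s := by
  induction s with
  | zero => simp [heightSeries]
  | succ s ih => simp [heightSeries, map_geomSeries, ih]

variable (R) in
/-- The generating function, by number of edges, of the one-sided planar trees of height `s`. -/
noncomputable def spineSeries (s : ℕ) : PowerSeries R :=
  X ^ s * ∏ j ∈ Finset.range s, heightSeries R (j + 1)

-- The root has a left-most child continuing the spine. Its other children form an arbitrary
-- sequence of edges carrying trees of height at most `s`, counted by the series of height `s + 1`.
variable (R) in
theorem spineSeries_succ (s : ℕ) :
    spineSeries R (s + 1) = X * heightSeries R (s + 1) * spineSeries R s := by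
  rw [spineSeries, spineSeries, Finset.prod_range_succ]
  ring

theorem map_spineSeries {S : Type*} [CommSemiring S] (φ : R →+* S) (s : ℕ) :
    PowerSeries.map φ (spineSeries R s) = spineSeries S s := by
  simp [spineSeries, map_heightSeries, map_prod]

theorem coeff_mul_spineSeries_of_lt (f : PowerSeries R) {N s : ℕ} (h : N < s) :
    coeff N (f * spineSeries R s) = 0 :=
  X_pow_dvd_iff.mp (Dvd.dvd.mul_left (Dvd.intro _ rfl) f) N h

/-- The generating function of the pairs of a one-sided planar tree of height `s` and `k` planar
trees of height at most `s`. -/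
noncomputable def ballCount (k s N : ℕ) : ℕ :=
  coeff N (heightSeries ℕ s ^ k * spineSeries ℕ s)

/-- The same counts are used over `ℝ≥0∞`, where sums over trees are rearranged freely, and over `ℝ`,
where the asymptotics are found. -/
theorem cast_ballCount (k s N : ℕ) :
    (ballCount k s N : R) = coeff N (heightSeries R s ^ k * spineSeries R s) := by
  rw [← map_heightSeries (Nat.castRingHom R), ← map_spineSeries (Nat.castRingHom R), ← map_pow,
    ← map_mul, coeff_map]
  rfl

theorem ballCount_of_lt (k : ℕ) {s N : ℕ} (h : N < s) : ballCount k s N = 0 :=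
  coeff_mul_spineSeries_of_lt _ h

end Series

/-! ### Power series converging absolutely at a point -/

section Summability

/-- The power series that converge absolutely at `c`. -/
def SummableAt (c : ℝ) (f : PowerSeries ℝ) : Prop := Summable fun n => ‖coeff n f * c ^ n‖

/-- The value of a power series at `c`. -/
noncomputable def valueAt (c : ℝ) (f : PowerSeries ℝ) : ℝ := ∑' n, coeff n f * c ^ n

variable {c : ℝ} {f g : PowerSeries ℝ}

theorem SummableAt.summable (hf : SummableAt c f) : Summable fun n => coeff n f * c ^ n :=
  Summable.of_norm hf

theorem SummableAt.add (hf : SummableAt c f) (hg : SummableAt c g) : SummableAt c (f + g) := by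
  unfold SummableAt
  simpa only [map_add, add_mul] using (hf.summable.add hg.summable).norm

theorem SummableAt.neg (hf : SummableAt c f) : SummableAt c (-f) := by
  unfold SummableAt at hf ⊢
  simpa only [map_neg, neg_mul, norm_neg] using hf

theorem SummableAt.sub (hf : SummableAt c f) (hg : SummableAt c g) : SummableAt c (f - g) :=
  sub_eq_add_neg f g ▸ hf.add hg.neg

theorem coeff_mul_mul_pow (c : ℝ) (f g : PowerSeries ℝ) (n : ℕ) :
    coeff n (f * g) * c ^ n =
      ∑ ij ∈ Finset.HasAntidiagonal.antidiagonal n, (coeff ij.1 f * c ^ ij.1) * (coeff ij.2 g * c ^ ij.2) := by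
  rw [coeff_mul, Finset.sum_mul]
  refine Finset.sum_congr rfl fun ij hij => ?_
  rw [← Finset.HasAntidiagonal.mem_antidiagonal.mp hij, pow_add]
  ring

theorem SummableAt.mul (hf : SummableAt c f) (hg : SummableAt c g) : SummableAt c (f * g) := by
  unfold SummableAt
  simp_rw [coeff_mul_mul_pow]
  exact summable_norm_sum_mul_antidiagonal_of_summable_norm
    (f := fun n => coeff n f * c ^ n) (g := fun n => coeff n g * c ^ n) hf hg

theorem valueAt_mul (hf : SummableAt c f) (hg : SummableAt c g) :
    valueAt c (f * g) = valueAt c f * valueAt c g := by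
  unfold valueAt
  simp_rw [coeff_mul_mul_pow]
  exact (tsum_mul_tsum_eq_tsum_sum_antidiagonal_of_summable_norm
    (f := fun n => coeff n f * c ^ n) (g := fun n => coeff n g * c ^ n) hf hg).symm

theorem valueAt_add (hf : SummableAt c f) (hg : SummableAt c g) :
    valueAt c (f + g) = valueAt c f + valueAt c g := by
  simp only [valueAt, map_add, add_mul, hf.summable.tsum_add hg.summable]

theorem valueAt_sub (hf : SummableAt c f) (hg : SummableAt c g) :
    valueAt c (f - g) = valueAt c f - valueAt c g := by
  simp only [valueAt, map_sub, sub_mul, hf.summable.tsum_sub hg.summable]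

theorem hasSum_valueAt_monomial (c : ℝ) (n : ℕ) (a : ℝ) :
    HasSum (fun m => coeff m (monomial n a) * c ^ m) (a * c ^ n) := by
  convert hasSum_single n fun m hm => ?_ using 1
  · simp
  · simp [coeff_monomial, hm]

theorem summableAt_monomial (c : ℝ) (n : ℕ) (a : ℝ) : SummableAt c (monomial n a) :=
  (hasSum_valueAt_monomial c n a).summable.norm

theorem valueAt_monomial (c : ℝ) (n : ℕ) (a : ℝ) : valueAt c (monomial n a) = a * c ^ n :=
  (hasSum_valueAt_monomial c n a).tsum_eq

theorem summableAt_C (c a : ℝ) : SummableAt c (C a) := by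
  simpa using summableAt_monomial c 0 a

theorem valueAt_C (c a : ℝ) : valueAt c (C a) = a := by simpa using valueAt_monomial c 0 a

theorem summableAt_one (c : ℝ) : SummableAt c 1 := by
  simpa using summableAt_C c 1

theorem valueAt_one (c : ℝ) : valueAt c 1 = 1 := by simpa using valueAt_C c 1

theorem summableAt_X (c : ℝ) : SummableAt c X := summableAt_monomial c 1 1

theorem valueAt_X (c : ℝ) : valueAt c X = c := by
  rw [X_eq, valueAt_monomial, one_mul, pow_one]

theorem SummableAt.pow (hf : SummableAt c f) (n : ℕ) : SummableAt c (f ^ n) := by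
  induction n with
  | zero => simpa using summableAt_one c
  | succ n ih => simpa [pow_succ] using ih.mul hf

theorem valueAt_pow (hf : SummableAt c f) (n : ℕ) : valueAt c (f ^ n) = valueAt c f ^ n := by
  induction n with
  | zero => simpa using valueAt_one c
  | succ n ih => rw [pow_succ, valueAt_mul (hf.pow n) hf, ih, pow_succ]

theorem SummableAt.of_le (hc : 0 ≤ c) (h0 : ∀ n, 0 ≤ coeff n f)
    (h : ∀ n, coeff n f ≤ coeff n g) (hg : SummableAt c g) : SummableAt c f := by
  refine Summable.of_norm_bounded hg.summable fun n => ?_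
  rw [norm_norm, Real.norm_of_nonneg (mul_nonneg (h0 n) (pow_nonneg hc n))]
  exact mul_le_mul_of_nonneg_right (h n) (pow_nonneg hc n)

theorem valueAt_nonneg (hc : 0 ≤ c) (h0 : ∀ n, 0 ≤ coeff n f) : 0 ≤ valueAt c f :=
  tsum_nonneg fun n => mul_nonneg (h0 n) (pow_nonneg hc n)

theorem coeff_mul_nonneg (hf : ∀ n, 0 ≤ coeff n f) (hg : ∀ n, 0 ≤ coeff n g) (n : ℕ) :
    0 ≤ coeff n (f * g) := by
  rw [coeff_mul]
  exact Finset.sum_nonneg fun ij _ => mul_nonneg (hf _) (hg _)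

open scoped PowerSeries.WithPiTopology in
/-- Summing a family of power series with nonnegative coefficients commutes with evaluation. -/
theorem hasSum_valueAt {F : ℕ → PowerSeries ℝ} (hc : 0 ≤ c) (h0 : ∀ s n, 0 ≤ coeff n (F s))
    (hF : ∀ s, SummableAt c (F s)) (hv : Summable fun s => valueAt c (F s)) (hf : HasSum F f) :
    SummableAt c f ∧ valueAt c f = ∑' s, valueAt c (F s) := by
  have hnn : ∀ x : ℕ × ℕ, 0 ≤ coeff x.2 (F x.1) * c ^ x.2 := fun x =>
    mul_nonneg (h0 _ _) (pow_nonneg hc _)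
  have hs : Summable fun x : ℕ × ℕ => coeff x.2 (F x.1) * c ^ x.2 :=
    (summable_prod_of_nonneg hnn).mpr ⟨fun s => (hF s).summable, hv⟩
  have hcoeff : ∀ n, coeff n f * c ^ n = ∑' s, coeff n (F s) * c ^ n := fun n => by
    rw [tsum_mul_right, ((PowerSeries.WithPiTopology.hasSum_iff_hasSum_coeff ℝ).mp hf n).tsum_eq]
  constructor
  · have := (hs.prod_symm.prod).norm
    unfold SummableAt
    simpa only [hcoeff, Prod.fst_swap, Prod.snd_swap, Prod.swap] using this
  · unfold valueAt
    simp_rw [hcoeff]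
    exact (Summable.tsum_comm (f := fun s n => coeff n (F s) * c ^ n) hs)

/-- If `f (1 - X / c)` converges absolutely at `c`, then the coefficients of `f`, rescaled, tend to
its value. -/
theorem tendsto_coeff_of_mul_one_sub (hc : c ≠ 0)
    (hg : SummableAt c g) (h : f * (1 - C c⁻¹ * X) = g) :
    Tendsto (fun n => coeff n f * c ^ n) atTop (𝓝 (valueAt c g)) := by
  -- Multiplication by `1 - X / c` takes successive differences of the rescaled coefficients, so
  -- those of `f` are the partial sums of `g` at `c`.
  have key : ∀ n, coeff n f * c ^ n = ∑ k ∈ Finset.range (n + 1), coeff k g * c ^ k := by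
    intro n
    have h' : f - C c⁻¹ * (f * X) = g := by rw [← h]; ring
    induction n with
    | zero => simp [← h']
    | succ n ih =>
      rw [Finset.sum_range_succ, ← ih, ← h', map_sub, coeff_C_mul, coeff_succ_mul_X, pow_succ]
      field_simp
      ring
  simp_rw [key]
  exact hg.summable.hasSum.tendsto_sum_nat.comp (tendsto_add_atTop_nat 1)

end Summability

/-! ### Values at `pq`: bounded-height trees, all finite trees, spines -/

section Asymptotics

/-- The generating function of all finite planar trees, by number of edges. -/
noncomputable def catalanGF : PowerSeries ℝ := PowerSeries.map (Nat.castRingHom ℝ) catalanSeries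

theorem catalanGF_eq : catalanGF = 1 + X * catalanGF ^ 2 := by
  have h := congrArg (PowerSeries.map (Nat.castRingHom ℝ)) catalanSeries_sq_mul_X_add_one
  simp only [map_add, map_mul, map_pow, map_one, map_X] at h
  rw [← catalanGF] at h
  linear_combination -h

theorem coeff_catalanGF (n : ℕ) : coeff n catalanGF = catalan n := by
  simp [catalanGF]

theorem coeff_heightSeries_nonneg (s n : ℕ) : 0 ≤ coeff n (heightSeries ℝ s) := by
  rw [← map_heightSeries (Nat.castRingHom ℝ), coeff_map]
  exact Nat.cast_nonneg _

theorem coeff_catalanGF_nonneg (n : ℕ) : 0 ≤ coeff n catalanGF := by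
  rw [coeff_catalanGF]
  exact Nat.cast_nonneg _

theorem coeff_spineSeries_nonneg (s n : ℕ) : 0 ≤ coeff n (spineSeries ℝ s) := by
  rw [← map_spineSeries (Nat.castRingHom ℝ), coeff_map]
  exact Nat.cast_nonneg _

theorem coeff_X_nonneg (n : ℕ) : 0 ≤ coeff n (X : PowerSeries ℝ) := by
  rw [coeff_X]
  split_ifs <;> simp

theorem coeff_pow_nonneg {f : PowerSeries ℝ} (hf : ∀ n, 0 ≤ coeff n f) (k n : ℕ) :
    0 ≤ coeff n (f ^ k) := by
  induction k generalizing n with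
  | zero =>
    rw [pow_zero, coeff_one]
    split_ifs <;> simp
  | succ k ih =>
    rw [pow_succ]
    exact coeff_mul_nonneg ih hf n

/-- Cross-multiplying the two functional equations cancels the product of the series. This recursion
yields coefficientwise positivity, agreement to order `s`, and the geometric rate of convergence. -/
theorem catalanGF_sub_heightSeries_succ (s : ℕ) :
    catalanGF - heightSeries ℝ (s + 1) =
      X * catalanGF * heightSeries ℝ (s + 1) * (catalanGF - heightSeries ℝ s) := by
  linear_combination heightSeries ℝ (s + 1) * catalanGF_eq - catalanGF * heightSeries_succ ℝ s

theorem coeff_catalanGF_sub_nonneg (s n : ℕ) : 0 ≤ coeff n (catalanGF - heightSeries ℝ s) := by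
  induction s generalizing n with
  | zero =>
    have h : catalanGF - heightSeries ℝ 0 = X * catalanGF ^ 2 := by
      rw [heightSeries]
      linear_combination catalanGF_eq
    rw [h]
    exact coeff_mul_nonneg coeff_X_nonneg (coeff_pow_nonneg coeff_catalanGF_nonneg 2) n
  | succ s ih =>
    rw [catalanGF_sub_heightSeries_succ]
    exact coeff_mul_nonneg (coeff_mul_nonneg (coeff_mul_nonneg coeff_X_nonneg
      coeff_catalanGF_nonneg) (coeff_heightSeries_nonneg _)) ih n

theorem X_pow_dvd_catalanGF_sub (s : ℕ) : X ^ (s + 1) ∣ catalanGF - heightSeries ℝ s := by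
  induction s with
  | zero =>
    refine ⟨catalanGF ^ 2, ?_⟩
    rw [heightSeries]
    linear_combination catalanGF_eq
  | succ s ih =>
    obtain ⟨f, hf⟩ := ih
    refine ⟨catalanGF * heightSeries ℝ (s + 1) * f, ?_⟩
    rw [catalanGF_sub_heightSeries_succ, hf]
    ring

theorem coeff_catalanGF_pow_sub_nonneg (k s n : ℕ) :
    0 ≤ coeff n (catalanGF ^ k - heightSeries ℝ s ^ k) := by
  induction k generalizing n with
  | zero => simp
  | succ k ih =>
    have h : catalanGF ^ (k + 1) - heightSeries ℝ s ^ (k + 1) =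
        catalanGF ^ k * (catalanGF - heightSeries ℝ s) +
          (catalanGF ^ k - heightSeries ℝ s ^ k) * heightSeries ℝ s := by ring
    rw [h, map_add]
    exact add_nonneg (coeff_mul_nonneg (coeff_pow_nonneg coeff_catalanGF_nonneg k)
      (coeff_catalanGF_sub_nonneg s) n) (coeff_mul_nonneg ih (coeff_heightSeries_nonneg s) n)

theorem catalan_le_four_pow (n : ℕ) : catalan n ≤ 4 ^ n := by
  rw [catalan_eq_centralBinom_div]
  refine (Nat.div_le_self _ _).trans ?_
  rw [Nat.centralBinom_eq_two_mul_choose]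
  refine (Nat.choose_le_two_pow _ _).trans_eq ?_
  rw [pow_mul]
  norm_num

variable {p q : ℝ}

/-- Catalan numbers are at most `4 ^ n`, and `4pq < (p + q)² = 1` because `p ≠ q`. -/
theorem summableAt_catalanGF (hp : 0 < p) (hpq : p < q) (h1 : p + q = 1) :
    SummableAt (p * q) catalanGF := by
  have hc : 0 ≤ p * q := by nlinarith
  refine SummableAt.of_le (g := PowerSeries.mk fun n => (4 : ℝ) ^ n) hc coeff_catalanGF_nonneg
    (fun n => ?_) ?_
  · rw [coeff_catalanGF, coeff_mk]
    exact_mod_cast catalan_le_four_pow n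
  · unfold SummableAt
    simp_rw [coeff_mk, ← mul_pow]
    refine (summable_geometric_of_lt_one (by positivity) ?_).norm
    nlinarith [sq_pos_of_pos (sub_pos.mpr hpq)]

theorem summableAt_heightSeries (hp : 0 < p) (hpq : p < q) (h1 : p + q = 1) (s : ℕ) :
    SummableAt (p * q) (heightSeries ℝ s) :=
  SummableAt.of_le (by nlinarith) (coeff_heightSeries_nonneg s)
    (fun n => sub_nonneg.mp (by simpa using coeff_catalanGF_sub_nonneg s n))
    (summableAt_catalanGF hp hpq h1)

theorem pow_sub_pow_pos (hp : 0 < p) (hpq : p < q) (s : ℕ) : 0 < q ^ (s + 1) - p ^ (s + 1) :=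
  sub_pos.mpr (pow_lt_pow_left₀ hpq hp.le (Nat.succ_ne_zero s))

/-- The Möbius recursion `y ↦ 1 / (1 - pq y)` is linearized by `u_s = q^s - p^s`: as `p + q = 1`,
the roots `p, q` give `u_{s+2} = u_{s+1} - pq u_s`. -/
theorem valueAt_heightSeries (hp : 0 < p) (hpq : p < q) (h1 : p + q = 1) (s : ℕ) :
    valueAt (p * q) (heightSeries ℝ s) =
      (q ^ (s + 1) - p ^ (s + 1)) / (q ^ (s + 2) - p ^ (s + 2)) := by
  have hS := summableAt_heightSeries hp hpq h1
  induction s with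
  | zero =>
    have h := pow_sub_pow_pos hp hpq 1
    rw [heightSeries, valueAt_one, eq_comm, div_eq_one_iff_eq h.ne']
    linear_combination -(q - p) * h1
  | succ s ih =>
    have h := congrArg (valueAt (p * q)) (heightSeries_succ ℝ s)
    have hX := summableAt_X (p * q)
    rw [valueAt_add (summableAt_one _) ((hX.mul (hS s)).mul (hS _)),
      valueAt_mul (hX.mul (hS s)) (hS _), valueAt_mul hX (hS s), ih, valueAt_one, valueAt_X] at h
    have hs := pow_sub_pow_pos hp hpq (s + 1)
    have hs' := pow_sub_pow_pos hp hpq (s + 2)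
    rw [eq_div_iff hs'.ne']
    field_simp at h
    have hr : q ^ (s + 2 + 1) - p ^ (s + 2 + 1) = (q ^ (s + 2) - p ^ (s + 2)) -
        p * q * (q ^ (s + 1) - p ^ (s + 1)) := by
      linear_combination (q ^ (s + 2) - p ^ (s + 2)) * h1
    rw [hr]
    linear_combination h

theorem valueAt_heightSeries_le (hp : 0 < p) (hpq : p < q) (h1 : p + q = 1) (s : ℕ) :
    valueAt (p * q) (heightSeries ℝ s) ≤ q⁻¹ := by
  rw [valueAt_heightSeries hp hpq h1, div_le_iff₀ (pow_sub_pow_pos hp hpq (s + 1)),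
    inv_mul_eq_div, le_div_iff₀ (hp.trans hpq)]
  have : 0 ≤ (q - p) * p ^ (s + 1) := mul_nonneg (sub_nonneg.mpr hpq.le) (by positivity)
  linear_combination this

/-- The quadratic equation factors as `(qv - 1)(pv - 1) = 0`. The root `1/p` is excluded because the
partial sums agree with those of bounded-height series, whose values are at most `1/q`. -/
theorem valueAt_catalanGF (hp : 0 < p) (hpq : p < q) (h1 : p + q = 1) :
    valueAt (p * q) catalanGF = q⁻¹ := by
  have hq : 0 < q := hp.trans hpq
  have hS := summableAt_catalanGF hp hpq h1
  have hX := summableAt_X (p * q)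
  have heq := congrArg (valueAt (p * q)) catalanGF_eq
  rw [valueAt_add (summableAt_one _) (hX.mul (hS.pow 2)), valueAt_mul hX (hS.pow 2),
    valueAt_pow hS, valueAt_one, valueAt_X] at heq
  have hle : valueAt (p * q) catalanGF ≤ q⁻¹ := by
    refine hS.summable.tsum_le_of_sum_range_le fun M => ?_
    refine le_trans ?_ (valueAt_heightSeries_le hp hpq h1 M)
    have hcoeff : ∀ n ∈ Finset.range M, coeff n catalanGF * (p * q) ^ n =
        coeff n (heightSeries ℝ M) * (p * q) ^ n := fun n hn => by
      have := X_pow_dvd_iff.mp (X_pow_dvd_catalanGF_sub M) n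
        (by have := Finset.mem_range.mp hn; omega)
      rw [map_sub, sub_eq_zero] at this
      rw [this]
    rw [Finset.sum_congr rfl hcoeff]
    exact (summableAt_heightSeries hp hpq h1 M).summable.sum_le_tsum _ fun n _ =>
      mul_nonneg (coeff_heightSeries_nonneg M n) (by positivity)
  set v := valueAt (p * q) catalanGF
  have hprod : (q * v - 1) * (p * v - 1) = 0 := by linear_combination -heq - v * h1
  have hpv : p * v - 1 ≠ 0 := by
    have : p * v ≤ p * q⁻¹ := mul_le_mul_of_nonneg_left hle hp.le
    have : p * q⁻¹ < 1 := by rwa [← div_eq_mul_inv, div_lt_one hq]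
    intro h
    linarith
  rcases mul_eq_zero.mp hprod with h | h
  · exact (inv_eq_of_mul_eq_one_right (sub_eq_zero.mp h)).symm
  · exact absurd h hpv

theorem valueAt_heightSeries_nonneg (hp : 0 < p) (hpq : p < q) (s : ℕ) :
    0 ≤ valueAt (p * q) (heightSeries ℝ s) :=
  valueAt_nonneg (mul_pos hp (hp.trans hpq)).le (coeff_heightSeries_nonneg s)

/-- Evaluate `catalanGF_sub_heightSeries_succ` at `pq`: there `x C = p` and the bounded-height value
is at most `1/q`, so each step contracts the gap by `p/q`. -/
theorem inv_sub_valueAt_heightSeries_le (hp : 0 < p) (hpq : p < q) (h1 : p + q = 1) (s : ℕ) :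
    q⁻¹ - valueAt (p * q) (heightSeries ℝ s) ≤ (p / q) ^ s * q⁻¹ := by
  have hq : 0 < q := hp.trans hpq
  have hy := valueAt_heightSeries_le hp hpq h1
  have hX := summableAt_X (p * q)
  have hC := summableAt_catalanGF hp hpq h1
  have hS := summableAt_heightSeries hp hpq h1
  induction s with
  | zero =>
    rw [pow_zero, one_mul]
    linarith [valueAt_heightSeries_nonneg hp hpq 0]
  | succ s ih =>
    have h := congrArg (valueAt (p * q)) (catalanGF_sub_heightSeries_succ s)
    rw [valueAt_sub hC (hS _), valueAt_mul ((hX.mul hC).mul (hS _)) (hC.sub (hS s)),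
      valueAt_mul (hX.mul hC) (hS _), valueAt_mul hX hC, valueAt_sub hC (hS s), valueAt_X,
      valueAt_catalanGF hp hpq h1, mul_assoc p, mul_inv_cancel₀ hq.ne', mul_one] at h
    rw [h, pow_succ, mul_comm _ (p / q), mul_assoc (p / q), div_eq_mul_inv]
    have h2 : 0 ≤ q⁻¹ - valueAt (p * q) (heightSeries ℝ s) := sub_nonneg.mpr (hy s)
    exact mul_le_mul (mul_le_mul_of_nonneg_left (hy _) hp.le) ih h2 (by positivity)

theorem summable_inv_sub_valueAt_pow (hp : 0 < p) (hpq : p < q) (h1 : p + q = 1) (k : ℕ) :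
    Summable fun s => q⁻¹ ^ k - valueAt (p * q) (heightSeries ℝ s) ^ k := by
  have hq : 0 < q := hp.trans hpq
  have hy := valueAt_heightSeries_le hp hpq h1
  have hy0 := valueAt_heightSeries_nonneg hp hpq
  have hbase : Summable fun s => q⁻¹ - valueAt (p * q) (heightSeries ℝ s) := by
    refine Summable.of_nonneg_of_le (fun s => sub_nonneg.mpr (hy s))
      (inv_sub_valueAt_heightSeries_le hp hpq h1) ?_
    exact (summable_geometric_of_lt_one (by positivity) ((div_lt_one hq).mpr hpq)).mul_right _
  induction k with
  | zero => simp
  | succ k ih =>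
    refine Summable.of_nonneg_of_le (fun s => sub_nonneg.mpr ?_) (fun s => ?_)
      ((hbase.mul_left (q⁻¹ ^ k)).add (ih.mul_right q⁻¹))
    · exact pow_le_pow_left₀ (hy0 s) (hy s) _
    · have h2 : 0 ≤ q⁻¹ ^ k - valueAt (p * q) (heightSeries ℝ s) ^ k :=
        sub_nonneg.mpr (pow_le_pow_left₀ (hy0 s) (hy s) _)
      have := mul_le_mul_of_nonneg_left (hy s) h2
      rw [pow_succ, pow_succ]
      linarith

/-- The terms of the renewal series. -/
noncomputable def renewalTerm (p : ℝ) (s : ℕ) : PowerSeries ℝ := C (p⁻¹ ^ s) * spineSeries ℝ s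

theorem renewalTerm_succ (p : ℝ) (s : ℕ) :
    renewalTerm p (s + 1) = C p⁻¹ * X * heightSeries ℝ (s + 1) * renewalTerm p s := by
  rw [renewalTerm, renewalTerm, spineSeries_succ, pow_succ, map_mul]
  ring

theorem renewalTerm_zero (p : ℝ) : renewalTerm p 0 = 1 := by
  simp [renewalTerm, spineSeries]

theorem coeff_C_nonneg {a : ℝ} (ha : 0 ≤ a) (n : ℕ) : 0 ≤ coeff n (C a : PowerSeries ℝ) := by
  rw [coeff_C]
  split_ifs
  exacts [ha, le_rfl]

theorem coeff_renewalTerm_nonneg (hp : 0 < p) (s n : ℕ) : 0 ≤ coeff n (renewalTerm p s) :=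
  coeff_mul_nonneg (coeff_C_nonneg (by positivity)) (coeff_spineSeries_nonneg s) n

theorem coeff_mul_renewalTerm_of_lt (f : PowerSeries ℝ) {N s : ℕ} (h : N < s) :
    coeff N (f * renewalTerm p s) = 0 := by
  rw [renewalTerm, ← mul_assoc]
  exact coeff_mul_spineSeries_of_lt _ h

theorem summableAt_renewalTerm (hp : 0 < p) (hpq : p < q) (h1 : p + q = 1) (s : ℕ) :
    SummableAt (p * q) (renewalTerm p s) := by
  induction s with
  | zero => simpa [renewalTerm_zero] using summableAt_one _
  | succ s ih =>
    rw [renewalTerm_succ]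
    exact (((summableAt_C _ _).mul (summableAt_X _)).mul
      (summableAt_heightSeries hp hpq h1 _)).mul ih

theorem valueAt_renewalTerm_succ (hp : 0 < p) (hpq : p < q) (h1 : p + q = 1) (s : ℕ) :
    valueAt (p * q) (renewalTerm p (s + 1)) =
      q * valueAt (p * q) (heightSeries ℝ (s + 1)) * valueAt (p * q) (renewalTerm p s) := by
  have hX := summableAt_X (p * q)
  have ha := summableAt_C (p * q) p⁻¹
  have hS := summableAt_heightSeries hp hpq h1 (s + 1)
  rw [renewalTerm_succ, valueAt_mul ((ha.mul hX).mul hS) (summableAt_renewalTerm hp hpq h1 s),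
    valueAt_mul (ha.mul hX) hS, valueAt_mul ha hX, valueAt_C, valueAt_X]
  field_simp

/-- The product of the closed forms telescopes, and `q² - p² = q - p`. -/
theorem valueAt_renewalTerm (hp : 0 < p) (hpq : p < q) (h1 : p + q = 1) (s : ℕ) :
    valueAt (p * q) (renewalTerm p s) = q ^ s * (q - p) / (q ^ (s + 2) - p ^ (s + 2)) := by
  induction s with
  | zero =>
    have h := pow_sub_pow_pos hp hpq 1
    rw [renewalTerm_zero, valueAt_one, eq_comm, div_eq_one_iff_eq h.ne']
    linear_combination -(q - p) * h1
  | succ s ih =>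
    have hs := pow_sub_pow_pos hp hpq (s + 1)
    have hs' := pow_sub_pow_pos hp hpq (s + 2)
    rw [valueAt_renewalTerm_succ hp hpq h1, ih, valueAt_heightSeries hp hpq h1]
    field_simp
    ring

theorem valueAt_renewalTerm_le_one (hp : 0 < p) (hpq : p < q) (h1 : p + q = 1) (s : ℕ) :
    valueAt (p * q) (renewalTerm p s) ≤ 1 := by
  have hq : 0 < q := hp.trans hpq
  induction s with
  | zero => rw [renewalTerm_zero, valueAt_one]
  | succ s ih =>
    rw [valueAt_renewalTerm_succ hp hpq h1]
    have h : q * valueAt (p * q) (heightSeries ℝ (s + 1)) ≤ 1 := by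
      have := mul_le_mul_of_nonneg_left (valueAt_heightSeries_le hp hpq h1 (s + 1)) hq.le
      rwa [mul_inv_cancel₀ hq.ne'] at this
    exact mul_le_one₀ h (valueAt_nonneg (by positivity) (coeff_renewalTerm_nonneg hp s)) ih

/-- Dropping `p ^ (s + 2)` from the denominator leaves this bound, uniform in `s`. Its positivity is
what keeps the defect's value below one. -/
theorem le_valueAt_renewalTerm (hp : 0 < p) (hpq : p < q) (h1 : p + q = 1) (s : ℕ) :
    (q - p) / q ^ 2 ≤ valueAt (p * q) (renewalTerm p s) := by
  have hq : 0 < q := hp.trans hpq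
  rw [valueAt_renewalTerm hp hpq h1, div_le_div_iff₀ (by positivity)
    (pow_sub_pow_pos hp hpq (s + 1))]
  have : 0 ≤ (q - p) * p ^ (s + 2) := mul_nonneg (sub_nonneg.mpr hpq.le) (by positivity)
  linear_combination this

end Asymptotics

/-! ### The renewal equation and the asymptotics of the counts -/

section Renewal

variable {p q : ℝ}

open scoped PowerSeries.WithPiTopology

theorem summable_mul_renewalTerm (f : ℕ → PowerSeries ℝ) (p : ℝ) :
    Summable fun s => f s * renewalTerm p s := by
  rw [PowerSeries.WithPiTopology.summable_iff_summable_coeff]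
  intro N
  refine summable_of_ne_finset_zero (s := Finset.range (N + 1)) fun s hs => ?_
  exact coeff_mul_renewalTerm_of_lt _ (by simpa [Nat.lt_succ_iff] using hs)

/-- The generating function of the weighted numbers of one-sided trees with a given ball. -/
noncomputable def renewalSeries (p : ℝ) (k : ℕ) : PowerSeries ℝ :=
  ∑' s, heightSeries ℝ s ^ k * renewalTerm p s

theorem hasSum_renewalSeries (p : ℝ) (k : ℕ) :
    HasSum (fun s => heightSeries ℝ s ^ k * renewalTerm p s) (renewalSeries p k) :=
  (summable_mul_renewalTerm _ p).hasSum

theorem coeff_renewalSeries (p : ℝ) (k N : ℕ) :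
    coeff N (renewalSeries p k) =
      ∑ s ∈ Finset.range (N + 1), p⁻¹ ^ s * (ballCount k s N : ℝ) := by
  rw [← ((PowerSeries.WithPiTopology.hasSum_iff_hasSum_coeff ℝ).mp
    (hasSum_renewalSeries p k) N).tsum_eq, tsum_eq_sum (s := Finset.range (N + 1))]
  · refine Finset.sum_congr rfl fun s _ => ?_
    rw [cast_ballCount, renewalTerm, mul_left_comm, coeff_C_mul]
  · intro s hs
    exact coeff_mul_renewalTerm_of_lt _ (by simpa [Nat.lt_succ_iff] using hs)

theorem hasSum_renewalTerm (p : ℝ) : HasSum (renewalTerm p) (renewalSeries p 0) := by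
  simpa using hasSum_renewalSeries p 0

/-- The defect in the renewal equation. -/
noncomputable def renewalDefect (p : ℝ) : PowerSeries ℝ :=
  1 - renewalSeries p 0 * (1 - C p⁻¹ * X * catalanGF)

/-- Replacing `y_{s+1}` by `C` in `P_{s+1} = p⁻¹ X y_{s+1} P_s` and summing over `s` gives the
renewal equation up to these errors. -/
theorem hasSum_renewalDefect (p : ℝ) :
    HasSum (fun s => C p⁻¹ * X * (catalanGF - heightSeries ℝ (s + 1)) * renewalTerm p s)
      (renewalDefect p) := by
  have h1 := (hasSum_renewalTerm p).mul_left (C p⁻¹ * X * catalanGF)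
  have h2 := (hasSum_nat_add_iff' 1).mpr (hasSum_renewalTerm p)
  have hf : ∀ s, C p⁻¹ * X * (catalanGF - heightSeries ℝ (s + 1)) * renewalTerm p s =
      C p⁻¹ * X * catalanGF * renewalTerm p s - renewalTerm p (s + 1) := fun s => by
    rw [renewalTerm_succ]
    ring
  have hR : renewalDefect p = C p⁻¹ * X * catalanGF * renewalSeries p 0 -
      (renewalSeries p 0 - ∑ i ∈ Finset.range 1, renewalTerm p i) := by
    rw [Finset.sum_range_one, renewalTerm_zero, renewalDefect]
    ring
  simp_rw [hf]
  rw [hR]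
  exact h1.sub h2

/-- At `pq` one has `p⁻¹ x C = 1`, so the values of the error terms telescope to `1 - P_n(pq)`,
which stays below `1 - (q - p)/q²`. -/
theorem renewalDefect_spec (hp : 0 < p) (hpq : p < q) (h1 : p + q = 1) :
    SummableAt (p * q) (renewalDefect p) ∧ valueAt (p * q) (renewalDefect p) < 1 := by
  have hq : 0 < q := hp.trans hpq
  have hc : 0 ≤ p * q := by positivity
  have hX := summableAt_X (p * q)
  have ha := summableAt_C (p * q) p⁻¹
  have hC := summableAt_catalanGF hp hpq h1
  have hS := summableAt_heightSeries hp hpq h1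
  have hP := summableAt_renewalTerm hp hpq h1
  have hsm : ∀ s, SummableAt (p * q) (C p⁻¹ * X * (catalanGF - heightSeries ℝ (s + 1)) *
      renewalTerm p s) := fun s => ((ha.mul hX).mul (hC.sub (hS _))).mul (hP s)
  have hnn : ∀ s n, 0 ≤ coeff n (C p⁻¹ * X * (catalanGF - heightSeries ℝ (s + 1)) *
      renewalTerm p s) := fun s => coeff_mul_nonneg (coeff_mul_nonneg (coeff_mul_nonneg
        (coeff_C_nonneg (by positivity)) coeff_X_nonneg) (coeff_catalanGF_sub_nonneg _))
        (coeff_renewalTerm_nonneg hp s)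
  have hval : ∀ s, valueAt (p * q) (C p⁻¹ * X * (catalanGF - heightSeries ℝ (s + 1)) *
      renewalTerm p s) = valueAt (p * q) (renewalTerm p s) -
        valueAt (p * q) (renewalTerm p (s + 1)) := fun s => by
    rw [valueAt_mul ((ha.mul hX).mul (hC.sub (hS _))) (hP s),
      valueAt_mul (ha.mul hX) (hC.sub (hS _)), valueAt_mul ha hX, valueAt_C, valueAt_X,
      valueAt_sub hC (hS _), valueAt_catalanGF hp hpq h1, valueAt_renewalTerm_succ hp hpq h1]
    field_simp
  have hpartial : ∀ n, ∑ s ∈ Finset.range n, valueAt (p * q) (C p⁻¹ * X *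
      (catalanGF - heightSeries ℝ (s + 1)) * renewalTerm p s) ≤ 1 - (q - p) / q ^ 2 := fun n => by
    simp_rw [hval]
    rw [Finset.sum_range_sub', renewalTerm_zero, valueAt_one]
    linarith [le_valueAt_renewalTerm hp hpq h1 n]
  have hsum := summable_of_sum_range_le (fun s => valueAt_nonneg hc (hnn s)) hpartial
  obtain ⟨h, h'⟩ := hasSum_valueAt hc hnn hsm hsum (hasSum_renewalDefect p)
  refine ⟨h, ?_⟩
  rw [h']
  have hpos : 0 < (q - p) / q ^ 2 := div_pos (sub_pos.mpr hpq) (by positivity)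
  linarith [hsum.tsum_le_of_sum_range_le hpartial]

/-- The terms `(C^k - y_s^k) P_s` have summable values at `pq`: the first factor decays
geometrically and `P_s(pq) ≤ 1`. Replacing `y_s^k` by `C^k` thus does not affect the singularity. -/
theorem summableAt_renewal_remainder (hp : 0 < p) (hpq : p < q) (h1 : p + q = 1) (k : ℕ) :
    SummableAt (p * q) (catalanGF ^ k * renewalSeries p 0 - renewalSeries p k) := by
  have hq : 0 < q := hp.trans hpq
  have hc : 0 ≤ p * q := by positivity
  have hC := summableAt_catalanGF hp hpq h1
  have hS := summableAt_heightSeries hp hpq h1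
  have hP := summableAt_renewalTerm hp hpq h1
  have hsum : HasSum (fun s => (catalanGF ^ k - heightSeries ℝ s ^ k) * renewalTerm p s)
      (catalanGF ^ k * renewalSeries p 0 - renewalSeries p k) := by
    simp_rw [sub_mul]
    exact ((hasSum_renewalTerm p).mul_left _).sub (hasSum_renewalSeries p k)
  have hsm : ∀ s, SummableAt (p * q) (catalanGF ^ k - heightSeries ℝ s ^ k) := fun s =>
    (hC.pow k).sub ((hS s).pow k)
  have hnn : ∀ s n, 0 ≤ coeff n ((catalanGF ^ k - heightSeries ℝ s ^ k) * renewalTerm p s) :=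
    fun s => coeff_mul_nonneg (coeff_catalanGF_pow_sub_nonneg k s) (coeff_renewalTerm_nonneg hp s)
  refine (hasSum_valueAt hc hnn (fun s => (hsm s).mul (hP s)) ?_ hsum).1
  refine Summable.of_nonneg_of_le (fun s => valueAt_nonneg hc (hnn s)) (fun s => ?_)
    (summable_inv_sub_valueAt_pow hp hpq h1 k)
  have hv : valueAt (p * q) (catalanGF ^ k - heightSeries ℝ s ^ k) =
      q⁻¹ ^ k - valueAt (p * q) (heightSeries ℝ s) ^ k := by
    rw [valueAt_sub (hC.pow k) ((hS s).pow k), valueAt_pow hC, valueAt_pow (hS s),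
      valueAt_catalanGF hp hpq h1]
  rw [valueAt_mul (hsm s) (hP s), ← hv]
  exact mul_le_of_le_one_right (valueAt_nonneg hc (coeff_catalanGF_pow_sub_nonneg k s))
    (valueAt_renewalTerm_le_one hp hpq h1 s)

/-- The renewal theorem for the weighted numbers of one-sided trees. -/
theorem exists_tendsto_ballCount (hp : 0 < p) (hpq : p < q) (h1 : p + q = 1) :
    ∃ L : ℝ, 0 < L ∧ ∀ k : ℕ, Tendsto (fun N : ℕ =>
      (∑ s ∈ Finset.range (N + 1), p⁻¹ ^ s * (ballCount k s N : ℝ)) * (p * q) ^ N) atTop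
        (𝓝 (L * q⁻¹ ^ k)) := by
  have hq : 0 < q := hp.trans hpq
  have hc : p * q ≠ 0 := by positivity
  have hX := summableAt_X (p * q)
  have hC := summableAt_catalanGF hp hpq h1
  obtain ⟨hR, hR1⟩ := renewalDefect_spec hp hpq h1
  -- The conjugate factor, with `p` replaced by `q`: times `1 - p⁻¹ X C` it gives the polynomial `1
  -- - X/(pq)`, and it does not vanish at `pq`.
  set J : PowerSeries ℝ := 1 - C q⁻¹ * X * catalanGF with hJ
  have hJs : SummableAt (p * q) J := (summableAt_one _).sub (((summableAt_C _ _).mul hX).mul hC)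
  have hJv : valueAt (p * q) J = 1 - p / q := by
    rw [hJ, valueAt_sub (summableAt_one _) (((summableAt_C _ _).mul hX).mul hC),
      valueAt_mul ((summableAt_C _ _).mul hX) hC, valueAt_mul (summableAt_C _ _) hX, valueAt_C,
      valueAt_X, valueAt_one, valueAt_catalanGF hp hpq h1]
    field_simp
  have hJprod : (1 - C p⁻¹ * X * catalanGF) * J = 1 - C (p * q)⁻¹ * X := by
    have hinv : p⁻¹ + q⁻¹ = (p * q)⁻¹ := by
      field_simp
      linarith
    have hCsum : C p⁻¹ + C q⁻¹ = (C (p * q)⁻¹ : PowerSeries ℝ) := by rw [← map_add, hinv]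
    have hCmul : C p⁻¹ * C q⁻¹ = (C (p * q)⁻¹ : PowerSeries ℝ) := by rw [← map_mul, mul_inv]
    rw [hJ]
    linear_combination (-X * catalanGF) * hCsum + X ^ 2 * catalanGF ^ 2 * hCmul -
      C (p * q)⁻¹ * X * catalanGF_eq
  refine ⟨(1 - valueAt (p * q) (renewalDefect p)) * (1 - p / q), ?_, fun k => ?_⟩
  · have : p / q < 1 := (div_lt_one hq).mpr hpq
    exact mul_pos (by linarith) (by linarith)
  · have hE := summableAt_renewal_remainder hp hpq h1 k
    set E := catalanGF ^ k * renewalSeries p 0 - renewalSeries p k with hEdef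
    have h1X : SummableAt (p * q) (1 - C (p * q)⁻¹ * X) :=
      (summableAt_one _).sub ((summableAt_C _ _).mul hX)
    -- The factor multiplying the remainder `E` vanishes at `pq`, so `E` drops out of the limit.
    have h1v : valueAt (p * q) (1 - C (p * q)⁻¹ * X) = 0 := by
      rw [valueAt_sub (summableAt_one _) ((summableAt_C _ _).mul hX),
        valueAt_mul (summableAt_C _ _) hX, valueAt_C, valueAt_X, valueAt_one,
        inv_mul_cancel₀ hc, sub_self]
    have h1R : SummableAt (p * q) (1 - renewalDefect p) := (summableAt_one _).sub hR
    have hmain : renewalSeries p k * (1 - C (p * q)⁻¹ * X) =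
        catalanGF ^ k * ((1 - renewalDefect p) * J) - E * (1 - C (p * q)⁻¹ * X) := by
      rw [← hJprod, hEdef, renewalDefect]
      ring
    have := tendsto_coeff_of_mul_one_sub hc
      (((hC.pow k).mul (h1R.mul hJs)).sub (hE.mul h1X)) hmain
    rw [valueAt_sub ((hC.pow k).mul (h1R.mul hJs)) (hE.mul h1X), valueAt_mul hE h1X, h1v,
      mul_zero, sub_zero, valueAt_mul (hC.pow k) (h1R.mul hJs), valueAt_pow hC,
      valueAt_mul h1R hJs, hJv, valueAt_sub (summableAt_one _) hR, valueAt_one,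
      valueAt_catalanGF hp hpq h1, mul_comm (q⁻¹ ^ k)] at this
    simpa only [coeff_renewalSeries] using this

end Renewal

/-! ### Levels, balls and one-generation extensions of trees -/

section Structure

theorem mem_of_append (T : PlaneTree) {v w : List ℕ} (h : v ++ w ∈ T.verts) : v ∈ T.verts := by
  induction w using List.reverseRecOn with
  | nil => simpa using h
  | append_singleton w i ih => exact ih (T.parent_mem _ i (by simpa using h))

theorem exists_numChildren (T : PlaneTree) (v : List ℕ) :
    ∃ n : ℕ, ∀ i : ℕ, v ++ [i] ∈ T.verts ↔ i < n := by
  classical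
  have hex : ∃ i : ℕ, v ++ [i] ∉ T.verts := by
    obtain ⟨i, hi⟩ := (T.finite_children v).exists_notMem
    exact ⟨i, hi⟩
  refine ⟨Nat.find hex, fun i => ⟨fun hi => ?_, fun hi => not_not.mp (Nat.find_min hex hi)⟩⟩
  by_contra hn
  exact Nat.find_spec hex (T.sibling_mem v i _ hi (not_lt.mp hn))

theorem level_zero (T : PlaneTree) : T.level 0 = {[]} := by
  ext v
  simp only [level, Set.mem_ofPred_eq, List.length_eq_zero_iff, Set.mem_singleton_iff]
  exact ⟨fun h => h.2, fun h => ⟨h ▸ T.root_mem, h⟩⟩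

theorem exists_of_mem_level_succ {T : PlaneTree} {r : ℕ} {w : List ℕ} (hw : w ∈ T.level (r + 1)) :
    ∃ v ∈ T.level r, ∃ i : ℕ, w = v ++ [i] := by
  obtain ⟨hw, hl⟩ := hw
  have hne : w ≠ [] := by
    rintro rfl
    simp at hl
  refine ⟨w.dropLast, ⟨?_, by simp [hl]⟩, w.getLast hne, (List.dropLast_append_getLast hne).symm⟩
  exact T.parent_mem _ (w.getLast hne) (by rwa [List.dropLast_append_getLast hne])

theorem level_finite (T : PlaneTree) (r : ℕ) : (T.level r).Finite := by
  induction r with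
  | zero => simp [level_zero]
  | succ r ih =>
    refine (ih.biUnion fun v _ => (T.finite_children v).image fun i => v ++ [i]).subset ?_
    intro w hw
    obtain ⟨v, hv, i, rfl⟩ := exists_of_mem_level_succ hw
    exact Set.mem_biUnion hv ⟨i, hw.1, rfl⟩

noncomputable instance (T : PlaneTree) (r : ℕ) : Fintype (T.level r) := (T.level_finite r).fintype

theorem rootBall_zero (T : PlaneTree) : T.rootBall 0 = {[]} := by
  rw [← T.level_zero]
  ext v
  simp [rootBall, level]

theorem rootBall_succ (T : PlaneTree) (r : ℕ) :
    T.rootBall (r + 1) = T.rootBall r ∪ T.level (r + 1) := by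
  ext v
  simp only [rootBall, level, Set.mem_ofPred_eq, Set.mem_union, ← and_or_left,
    Nat.le_succ_iff]

theorem disjoint_rootBall_level (T : PlaneTree) (r : ℕ) :
    Disjoint (T.rootBall r) (T.level (r + 1)) :=
  Set.disjoint_left.mpr fun v h h' => by
    have := h.2
    have := h'.2
    omega

theorem rootBall_finite (T : PlaneTree) (r : ℕ) : (T.rootBall r).Finite := by
  induction r with
  | zero => simp [rootBall_zero]
  | succ r ih => exact T.rootBall_succ r ▸ ih.union (T.level_finite _)

theorem rootBall_subset_verts (T : PlaneTree) (r : ℕ) : T.rootBall r ⊆ T.verts := fun _ h => h.1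

theorem nil_mem_rootBall (T : PlaneTree) (r : ℕ) : [] ∈ T.rootBall r :=
  ⟨T.root_mem, Nat.zero_le _⟩

/-- `T` has height at most `h`. -/
def HeightLE (T : PlaneTree) (h : ℕ) : Prop := ∀ v ∈ T.verts, v.length ≤ h

theorem heightLE_iff {T : PlaneTree} {h : ℕ} : T.HeightLE h ↔ T.rootBall h = T.verts :=
  ⟨fun H => Set.Subset.antisymm (T.rootBall_subset_verts h) fun v hv => ⟨hv, H v hv⟩,
    fun H _ hv => (H ▸ hv : _ ∈ T.rootBall h).2⟩

theorem HeightLE.mono {T : PlaneTree} {h h' : ℕ} (H : T.HeightLE h) (hh : h ≤ h') :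
    T.HeightLE h' := fun v hv => (H v hv).trans hh

theorem level_eq_of_rootBall_eq {T T' : PlaneTree} {r : ℕ} (h : T.rootBall r = T'.rootBall r) :
    T.level r = T'.level r := by
  ext v
  have := Set.ext_iff.mp h v
  simp only [rootBall, level, Set.mem_ofPred_eq] at this ⊢
  constructor <;> rintro ⟨h1, h2⟩
  · exact ⟨(this.mp ⟨h1, h2.le⟩).1, h2⟩
  · exact ⟨(this.mpr ⟨h1, h2.le⟩).1, h2⟩

theorem mem_verts_iff_of_rootBall_eq {T T' : PlaneTree} {r : ℕ}
    (h : T.rootBall r = T'.rootBall r) {v : List ℕ} (hv : v.length ≤ r) :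
    v ∈ T.verts ↔ v ∈ T'.verts := by
  have := Set.ext_iff.mp h v
  simpa [rootBall, hv] using this

/-- `B_r(T)` as a tree. -/
def truncate (T : PlaneTree) (r : ℕ) (hr : 1 ≤ r) : PlaneTree where
  verts := T.rootBall r
  root_mem := T.nil_mem_rootBall r
  parent_mem v i h := ⟨T.parent_mem v i h.1, by
    have := h.2
    simp only [List.length_append, List.length_singleton] at this
    omega⟩
  sibling_mem v i j h hj := ⟨T.sibling_mem v i j h.1 hj, by simpa using h.2⟩
  finite_children v := (T.finite_children v).subset fun _ h => h.1
  root_degree_one i := by simp [rootBall, T.root_degree_one, hr]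

theorem heightLE_truncate (T : PlaneTree) {r : ℕ} (hr : 1 ≤ r) : (T.truncate r hr).HeightLE r :=
  fun _ hv => hv.2

theorem rootBall_truncate (T : PlaneTree) {r s : ℕ} (hr : 1 ≤ r) (hs : s ≤ r) :
    (T.truncate r hr).rootBall s = T.rootBall s := by
  ext v
  exact ⟨fun h => ⟨h.1.1, h.2⟩, fun h => ⟨⟨h.1, h.2.trans hs⟩, h.2⟩⟩

/-- The extension of `B_r(T)` in which each vertex `v` at distance `r` from the root has `c v`
children. -/
def extend (T : PlaneTree) (r : ℕ) (hr : 1 ≤ r) (c : T.level r → ℕ) : PlaneTree where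
  verts := T.rootBall r ∪ {w | ∃ v : T.level r, ∃ i < c v, w = v.1 ++ [i]}
  root_mem := Or.inl (T.nil_mem_rootBall r)
  parent_mem v i h := by
    rcases h with h | ⟨v', i', -, h⟩
    · exact Or.inl ((T.truncate r hr).parent_mem v i h)
    · obtain ⟨rfl, -⟩ := List.append_inj' h rfl
      exact Or.inl ⟨v'.2.1, v'.2.2.le⟩
  sibling_mem v i j h hj := by
    rcases h with h | ⟨v', i', hi', h⟩
    · exact Or.inl ((T.truncate r hr).sibling_mem v i j h hj)
    · obtain ⟨rfl, h2⟩ := List.append_inj' h rfl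
      obtain rfl : i = i' := by simpa using h2
      exact Or.inr ⟨v', j, hj.trans_lt hi', rfl⟩
  finite_children v := by
    by_cases hv : v ∈ T.level r
    · refine ((T.finite_children v).union (Set.finite_Iio (c ⟨v, hv⟩))).subset ?_
      rintro i (h | ⟨v', i', hi', h⟩)
      · exact Or.inl h.1
      · obtain ⟨rfl, h2⟩ := List.append_inj' h rfl
        obtain rfl : i = i' := by simpa using h2
        exact Or.inr hi'
    · refine (T.finite_children v).subset ?_
      rintro i (h | ⟨v', i', hi', h⟩)
      · exact h.1
      · obtain ⟨rfl, h2⟩ := List.append_inj' h rfl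
        exact absurd v'.2 hv
  root_degree_one i := by
    rw [← (T.truncate r hr).root_degree_one i]
    refine ⟨fun h => ?_, Or.inl⟩
    rcases h with h | ⟨v', i', -, h⟩
    · exact h
    · obtain ⟨h1, -⟩ := List.append_inj' (s₁ := []) (t₁ := [i]) h rfl
      have := v'.2.2
      rw [← h1, List.length_nil] at this
      omega

variable {T T' : PlaneTree} {r : ℕ} (hr : 1 ≤ r)

theorem heightLE_extend (c : T.level r → ℕ) : (T.extend r hr c).HeightLE (r + 1) := by
  rintro v (h | ⟨v', i', -, rfl⟩)
  · exact h.2.trans (Nat.le_succ r)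
  · simp [v'.2.2]

theorem rootBall_extend (c : T.level r → ℕ) : (T.extend r hr c).rootBall r = T.rootBall r := by
  ext v
  constructor
  · rintro ⟨h | ⟨v', i', -, rfl⟩, h'⟩
    · exact h
    · simp [v'.2.2] at h'
  · exact fun h => ⟨Or.inl h, h.2⟩

theorem append_mem_extend {c : T.level r → ℕ} (v : T.level r) (i : ℕ) :
    v.1 ++ [i] ∈ (T.extend r hr c).verts ↔ i < c v := by
  constructor
  · rintro (h | ⟨v', i', hi', h⟩)
    · have := h.2
      simp [v.2.2] at this
    · obtain ⟨h1, h2⟩ := List.append_inj' h rfl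
      obtain rfl : i = i' := by simpa using h2
      obtain rfl : v = v' := Subtype.ext h1
      exact hi'
  · exact fun h => Or.inr ⟨v, i, h, rfl⟩

/-- Every tree that agrees with `T` up to height `r` agrees up to height `r + 1` with an
extension of `B_r(T)`. -/
theorem existsUnique_extend (h : T'.rootBall r = T.rootBall r) :
    ∃! c : T.level r → ℕ, T'.rootBall (r + 1) = (T.extend r hr c).rootBall (r + 1) := by
  choose n hn using T'.exists_numChildren
  refine ⟨fun v => n v.1, ?_, fun c hc => ?_⟩
  · change _ = (T.extend r hr fun v => n v.1).rootBall (r + 1)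
    rw [heightLE_iff.mp (heightLE_extend hr _), rootBall_succ, h]
    refine congrArg (T.rootBall r ∪ ·) (Set.ext fun w => ⟨fun hw => ?_, ?_⟩)
    · obtain ⟨v, hv, i, rfl⟩ := exists_of_mem_level_succ hw
      exact ⟨⟨v, level_eq_of_rootBall_eq h ▸ hv⟩, i, (hn v i).mp hw.1, rfl⟩
    · rintro ⟨v, i, hi, rfl⟩
      exact ⟨(hn _ i).mpr hi, by simp [v.2.2]⟩
  · funext v
    refine eq_of_forall_lt_iff fun i => ?_
    rw [← append_mem_extend hr, ← hn, mem_verts_iff_of_rootBall_eq hc (by simp [v.2.2])]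

theorem rootBall_eq_of_extend {c : T.level r → ℕ}
    (h : T'.rootBall (r + 1) = (T.extend r hr c).rootBall (r + 1)) :
    T'.rootBall r = T.rootBall r :=
  (rootBall_mono (Nat.le_succ r) h).trans (rootBall_extend hr c)

/-- The trees `T'` with `B_r(T') = B_r(T)`. -/
def cylinder (T : PlaneTree) (r : ℕ) : Set PlaneTree := {T' | T'.rootBall r = T.rootBall r}

theorem mem_cylinder {s : ℕ} : T' ∈ T.cylinder s ↔ T'.rootBall s = T.rootBall s := Iff.rfl

/-- Summation over the trees with a given ball, by the ball of the next radius. -/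
theorem tsum_indicator_rootBall (f : PlaneTree → ℝ≥0∞) :
    ∑' T', (T.cylinder r).indicator f T' =
      ∑' c : T.level r → ℕ, ∑' T', ((T.extend r hr c).cylinder (r + 1)).indicator f T' := by
  rw [ENNReal.tsum_comm]
  refine tsum_congr fun T' => ?_
  by_cases h : T' ∈ T.cylinder r
  · obtain ⟨c, hc, hu⟩ := existsUnique_extend hr h
    rw [Set.indicator_of_mem h, tsum_eq_single c, Set.indicator_of_mem (mem_cylinder.mpr hc)]
    intro c' hc'
    rw [Set.indicator_of_notMem]
    exact fun hm => hc' (hu c' hm)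
  · rw [Set.indicator_of_notMem h, eq_comm, ENNReal.tsum_eq_zero]
    intro c
    rw [Set.indicator_of_notMem]
    exact fun hm => h (rootBall_eq_of_extend hr hm)

/-- The number of edges of `B_r(T)`. -/
noncomputable def ballSize (T : PlaneTree) (r : ℕ) : ℕ := (T.rootBall r).ncard - 1

theorem ballSize_add_one (T : PlaneTree) (r : ℕ) : T.ballSize r + 1 = (T.rootBall r).ncard :=
  Nat.sub_add_cancel ((Set.ncard_pos (T.rootBall_finite r)).mpr ⟨_, T.nil_mem_rootBall r⟩)

theorem card_level_extend (c : T.level r → ℕ) :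
    ((T.extend r hr c).level (r + 1)).ncard = ∑ v, c v := by
  have h : (T.extend r hr c).level (r + 1) =
      Set.range fun x : (Σ v : T.level r, Fin (c v)) => x.1.1 ++ [(x.2 : ℕ)] := by
    ext w
    constructor
    · rintro ⟨h | ⟨v, i, hi, rfl⟩, h'⟩
      · have := h.2
        omega
      · exact ⟨⟨v, i, hi⟩, rfl⟩
    · rintro ⟨⟨v, i⟩, rfl⟩
      exact ⟨(append_mem_extend hr v i).mpr i.2, by simp [v.2.2]⟩
  have hinj : Function.Injective
      fun x : (Σ v : T.level r, Fin (c v)) => x.1.1 ++ [(x.2 : ℕ)] := by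
    rintro ⟨v, i⟩ ⟨v', i'⟩ hx
    obtain ⟨h1, h2⟩ := List.append_inj' hx rfl
    obtain rfl : v = v' := Subtype.ext h1
    obtain rfl : i = i' := Fin.ext (by simpa using h2)
    rfl
  rw [h, ← Set.image_univ, Set.ncard_image_of_injective _ hinj, Set.ncard_univ,
    Nat.card_eq_fintype_card, Fintype.card_sigma]
  simp

theorem ballSize_succ (T : PlaneTree) (r : ℕ) :
    T.ballSize (r + 1) = T.ballSize r + (T.level (r + 1)).ncard := by
  have h := T.ballSize_add_one (r + 1)
  rw [rootBall_succ, Set.ncard_union_eq (T.disjoint_rootBall_level r) (T.rootBall_finite r)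
    (T.level_finite _), ← ballSize_add_one] at h
  omega

theorem ballSize_congr (h : T'.rootBall r = T.rootBall r) : T'.ballSize r = T.ballSize r := by
  rw [ballSize, ballSize, h]

theorem ballSize_extend (c : T.level r → ℕ) :
    (T.extend r hr c).ballSize (r + 1) = T.ballSize r + ∑ v, c v := by
  rw [ballSize_succ, card_level_extend, ballSize_congr (rootBall_extend hr c)]

theorem ballSize_one (T : PlaneTree) : T.ballSize 1 = 1 := by
  have h : T.rootBall 1 = {[], [0]} := by
    ext v
    match v with
    | [] => simp [rootBall, T.root_mem]
    | [i] => simp [rootBall, T.root_degree_one]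
    | _ :: _ :: _ => simp [rootBall]
  rw [ballSize, h, Set.ncard_pair (by simp)]

theorem card_level_one (T : PlaneTree) : (T.level 1).ncard = 1 := by
  have h := ballSize_succ T 0
  rwa [zero_add, ballSize_one, ballSize, rootBall_zero, Set.ncard_singleton, Nat.sub_self,
    zero_add, eq_comm] at h

theorem size_eq_encard (T : PlaneTree) : T.size = (T.verts \ {[]}).encard := by
  have h : Prod.snd '' T.edges = T.verts \ {[]} := by
    ext w
    constructor
    · rintro ⟨⟨v, w⟩, ⟨hw, i, hi⟩, rfl⟩
      refine ⟨hw, fun h => ?_⟩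
      have h' : w = [] := h
      simp [h'] at hi
    · rintro ⟨hw, hne⟩
      exact ⟨(w.dropLast, w), ⟨hw, w.getLast hne, (List.dropLast_append_getLast hne).symm⟩, rfl⟩
  rw [size, ← h, Set.InjOn.encard_image]
  rintro ⟨v, w⟩ ⟨-, i, hi⟩ ⟨v', w'⟩ ⟨-, i', hi'⟩ h
  simp only at h hi hi'
  rw [← h, hi] at hi'
  rw [h, (List.append_inj' hi' rfl).1]

theorem HeightLE.size_eq {h : ℕ} (H : T.HeightLE h) : T.size = T.ballSize h := by
  rw [size_eq_encard, ← heightLE_iff.mp H, ballSize,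
    ← Set.ncard_sdiff_singleton_of_mem (T.nil_mem_rootBall h),
    ← ((T.rootBall_finite h).subset Set.sdiff_subset).cast_ncard_eq]

theorem HeightLE.eq_truncate (H : T'.HeightLE r) (h : T'.rootBall r = T.rootBall r) :
    T' = T.truncate r hr :=
  PlaneTree.ext (by rw [← heightLE_iff.mp H, h]; rfl)

end Structure

/-! ### Sums over the numbers of children of a generation -/

section PiSum

theorem coeff_mul_of_tsum {φ : ℕ → PowerSeries ℝ≥0∞} {G : PowerSeries ℝ≥0∞}
    (hG : ∀ n, coeff n G = ∑' k, coeff n (φ k)) (A : PowerSeries ℝ≥0∞) (N : ℕ) :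
    coeff N (A * G) = ∑' k, coeff N (A * φ k) := by
  simp_rw [coeff_mul, hG, ← ENNReal.tsum_mul_left]
  exact (Summable.tsum_finsetSum fun _ _ => ENNReal.summable).symm

/-- A finite product of sums of power series, multiplied out. -/
theorem coeff_mul_prod_of_tsum {ι : Type*} [Fintype ι] {φ : ι → ℕ → PowerSeries ℝ≥0∞}
    {G : ι → PowerSeries ℝ≥0∞} (hG : ∀ i n, coeff n (G i) = ∑' k, coeff n (φ i k))
    (A : PowerSeries ℝ≥0∞) (N : ℕ) :
    coeff N (A * ∏ i, G i) = ∑' c : ι → ℕ, coeff N (A * ∏ i, φ i (c i)) := by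
  revert φ G A
  refine Fintype.induction_empty_option (P := fun ι _ => ∀ {φ : ι → ℕ → PowerSeries ℝ≥0∞}
    {G : ι → PowerSeries ℝ≥0∞}, (∀ i n, coeff n (G i) = ∑' k, coeff n (φ i k)) →
    ∀ A : PowerSeries ℝ≥0∞, coeff N (A * ∏ i, G i) =
      ∑' c : ι → ℕ, coeff N (A * ∏ i, φ i (c i))) ?_ ?_ ?_ ι
  · intro α β _ e ih φ G hG A
    let := Fintype.ofEquiv β e.symm
    have h := ih (φ := φ ∘ e) (G := G ∘ e) (fun i => hG (e i)) A
    rw [← (e.arrowCongr (Equiv.refl ℕ)).tsum_eq]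
    have hprod : ∀ c : α → ℕ, ∏ i, φ i (e.arrowCongr (Equiv.refl ℕ) c i) =
        ∏ i, (φ ∘ e) i (c i) := fun c =>
      (Fintype.prod_equiv e _ _ fun i => by simp [Equiv.arrowCongr]).symm
    simp_rw [hprod]
    rw [← h]
    exact congrArg (fun P => coeff N (A * P)) (Fintype.prod_equiv e _ _ fun _ => rfl).symm
  · intro φ G _ A
    rw [tsum_eq_single default fun c hc => absurd (Subsingleton.elim c default) hc]
    simp
  · intro α _ ih φ G hG A
    rw [← (Equiv.piOptionEquivProd (β := fun _ => ℕ)).symm.tsum_eq,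
      ENNReal.tsum_prod (f := fun k c => coeff N (A * ∏ i,
        φ i ((Equiv.piOptionEquivProd (β := fun _ => ℕ)).symm (k, c) i)))]
    simp only [Fintype.prod_option, ← mul_assoc]
    -- The factor of the added index is expanded first; each of its terms is then absorbed into `A`,
    -- which is why the statement carries an arbitrary factor `A`.
    rw [mul_right_comm, coeff_mul_of_tsum (hG none)]
    refine tsum_congr fun k => ?_
    rw [mul_right_comm, ih fun i => hG (some i)]
    rfl

/-- Summation over the numbers of children of the vertices of a level. -/
theorem tsum_children {ι : Type*} [Fintype ι] {y G : PowerSeries ℝ≥0∞}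
    (hG : ∀ n, coeff n G = ∑' k, coeff n (y ^ k)) (A : PowerSeries ℝ≥0∞) (N : ℕ) :
    ∑' c : ι → ℕ, coeff N (A * y ^ ∑ i, c i) = coeff N (A * G ^ Fintype.card ι) := by
  have h := coeff_mul_prod_of_tsum (ι := ι) (φ := fun _ k => y ^ k) (fun _ => hG) A N
  simp only [Finset.prod_const, Finset.card_univ, Finset.prod_pow_eq_pow_sum] at h
  exact h.symm

/-- Summation over the numbers of children of the vertices of a level, when a marked vertex has at
least one child. -/
theorem tsum_children_marked {ι : Type*} [Fintype ι] (i₀ : ι) {z y G : PowerSeries ℝ≥0∞}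
    (hG : ∀ n, coeff n G = ∑' k, coeff n ((z * y) ^ k)) (A : PowerSeries ℝ≥0∞) (N : ℕ) :
    ∑' c : ι → ℕ, (if c i₀ = 0 then 0 else
        coeff N (A * (z ^ (∑ i, c i) * y ^ (∑ i, c i - 1)))) =
      coeff N (A * (z * G ^ Fintype.card ι)) := by
  classical
  -- The marked index contributes `∑_{k ≥ 1} z^k y^{k-1} = z ∑_k (z y)^k`.
  have hG' : ∀ n, coeff n (z * G) =
      ∑' k, coeff n (if k = 0 then 0 else z ^ k * y ^ (k - 1)) := fun n => by
    rw [tsum_eq_zero_add' ENNReal.summable, coeff_mul_of_tsum hG]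
    simp only [if_pos, map_zero, zero_add, Nat.succ_ne_zero, if_false, Nat.add_sub_cancel]
    exact tsum_congr fun k => by rw [mul_pow, pow_succ', mul_assoc]
  have h := coeff_mul_prod_of_tsum (ι := ι)
    (φ := fun i k => if i = i₀ then (if k = 0 then 0 else z ^ k * y ^ (k - 1)) else (z * y) ^ k)
    (G := fun i => if i = i₀ then z * G else G)
    (fun i n => by
      by_cases hi : i = i₀
      · simp only [hi, if_true]
        exact hG' n
      · simp only [hi, if_false]
        exact hG n) A N
  have herase : ∀ f g : ι → PowerSeries ℝ≥0∞, ∏ i, (if i = i₀ then f i else g i) =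
      f i₀ * ∏ i ∈ Finset.univ.erase i₀, g i := fun f g => by
    rw [← Finset.mul_prod_erase _ _ (Finset.mem_univ i₀), if_pos rfl]
    congr 1
    exact Finset.prod_congr rfl fun i hi => if_neg (Finset.ne_of_mem_erase hi)
  have hcard : Fintype.card ι = (Finset.univ.erase i₀).card + 1 := by
    rw [Finset.card_erase_add_one (Finset.mem_univ i₀), Finset.card_univ]
  rw [herase, Finset.prod_const] at h
  rw [hcard, pow_succ', ← mul_assoc z, h]
  refine tsum_congr fun c => ?_
  rw [herase]
  have hsum := Finset.add_sum_erase Finset.univ c (Finset.mem_univ i₀)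
  by_cases hc : c i₀ = 0
  · simp [hc]
  · rw [if_neg hc, if_neg hc, Finset.prod_pow_eq_pow_sum, ← hsum]
    obtain ⟨m, hm⟩ := Nat.exists_eq_succ_of_ne_zero hc
    simp only [hm, Nat.succ_eq_add_one, Nat.add_sub_cancel]
    rw [show m + 1 + ∑ x ∈ Finset.univ.erase i₀, c x - 1 =
      m + ∑ x ∈ Finset.univ.erase i₀, c x by omega, mul_pow, pow_add, pow_add]
    ring_nf

end PiSum

/-! ### Counting one-sided trees with a given ball -/

section Counting

variable {T : PlaneTree} {r : ℕ}

/-- The trees of height at most `h` that have a left-most path of length `h`. -/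
def spined (h : ℕ) : Set PlaneTree := {T | T.HeightLE h ∧ List.replicate h 0 ∈ T.verts}

theorem replicate_mem_of_le {a b : ℕ} (hab : a ≤ b) (h : List.replicate b 0 ∈ T.verts) :
    List.replicate a 0 ∈ T.verts :=
  T.mem_of_append (w := List.replicate (b - a) 0) (by
    rwa [List.replicate_append_replicate, Nat.add_sub_cancel' hab])

theorem replicate_mem_level (h : List.replicate r 0 ∈ T.verts) :
    List.replicate r 0 ∈ T.level r := ⟨h, List.length_replicate⟩

theorem replicate_mem_extend (hr : 1 ≤ r) (h : List.replicate r 0 ∈ T.verts)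
    (c : T.level r → ℕ) : List.replicate (r + 1) 0 ∈ (T.extend r hr c).verts ↔
      c ⟨_, replicate_mem_level h⟩ ≠ 0 := by
  rw [List.replicate_succ', append_mem_extend hr ⟨_, replicate_mem_level h⟩, pos_iff_ne_zero]

theorem indicator_spined_eq_zero {h : ℕ} (f : PlaneTree → ℝ≥0∞) (hrh : r ≤ h)
    (hn : List.replicate r 0 ∉ T.verts) (T' : PlaneTree) :
    (T.cylinder r).indicator ((spined h).indicator f) T' = 0 := by
  rw [Set.indicator_apply_eq_zero]
  intro hT'
  refine Set.indicator_of_notMem (fun hs => hn ?_) _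
  exact (mem_verts_iff_of_rootBall_eq hT' List.length_replicate.le).mp
    (replicate_mem_of_le hrh hs.2)

/-- Trees of height at most `r` with a given ball of radius `r`. -/
theorem tsum_indicator_cylinder_of_heightLE (hr : 1 ≤ r) (f : PlaneTree → ℝ≥0∞)
    (hf : ∀ T', ¬ HeightLE T' r → f T' = 0) :
    ∑' T', (T.cylinder r).indicator f T' = f (T.truncate r hr) := by
  rw [tsum_eq_single (T.truncate r hr), Set.indicator_of_mem]
  · exact rootBall_truncate T hr le_rfl
  · intro T' hT'
    rw [Set.indicator_apply_eq_zero]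
    exact fun h => hf T' fun H => hT' (H.eq_truncate hr h)

theorem coeff_heightSeries_succ (s n : ℕ) : coeff n (heightSeries ℝ≥0∞ (s + 1)) =
    ∑' k, coeff n ((X * heightSeries ℝ≥0∞ s) ^ k) := by
  rw [heightSeries, coeff_geomSeries (by simp) (Nat.lt_succ_self n), eq_comm]
  refine tsum_eq_sum fun k hk => coeff_pow_of_lt (by simp) ?_
  simpa [Nat.lt_succ_iff] using hk

/-- The number of one-sided trees of given height and size with a given ball. -/
theorem tsum_spined_size (hr : 1 ≤ r) (h0 : List.replicate r 0 ∈ T.verts) (s N : ℕ) :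
    ∑' T', (T.cylinder r).indicator ((spined (r + s)).indicator
        ({T' : PlaneTree | T'.size = (N : ℕ∞)}.indicator 1)) T' =
      coeff N (X ^ T.ballSize r *
        (heightSeries ℝ≥0∞ s ^ ((T.level r).ncard - 1) * spineSeries ℝ≥0∞ s)) := by
  induction s generalizing r T with
  | zero =>
    rw [tsum_indicator_cylinder_of_heightLE hr _ fun T' hT' =>
      Set.indicator_of_notMem (fun h => hT' h.1) _]
    have hs : T.truncate r hr ∈ spined (r + 0) :=
      ⟨T.heightLE_truncate hr, h0, List.length_replicate.le⟩
    rw [Set.indicator_of_mem hs]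
    simp only [heightSeries, spineSeries, one_pow, pow_zero, Finset.range_zero, Finset.prod_empty,
      mul_one, coeff_X_pow, Set.indicator_apply, Set.mem_ofPred_eq, Pi.one_apply,
      (T.heightLE_truncate hr).size_eq, ballSize_congr (rootBall_truncate T hr le_rfl),
      Nat.cast_inj, eq_comm]
  | succ s ih =>
    rw [tsum_indicator_rootBall hr]
    -- The next generation has `∑ v, c v` vertices. The first child of the spine vertex continues
    -- the spine, and the other `∑ v, c v - 1` carry trees of height at most `s`. If the spine
    -- vertex has no child, nothing is counted.
    have hstep : ∀ c : T.level r → ℕ, ∑' T', ((T.extend r hr c).cylinder (r + 1)).indicator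
        ((spined (r + (s + 1))).indicator ({T' : PlaneTree | T'.size = (N : ℕ∞)}.indicator 1)) T' =
        if c ⟨_, replicate_mem_level h0⟩ = 0 then 0 else
          coeff N ((X ^ T.ballSize r * spineSeries ℝ≥0∞ s) *
            (X ^ (∑ v, c v) * heightSeries ℝ≥0∞ s ^ (∑ v, c v - 1))) := fun c => by
      split_ifs with hc
      · exact ENNReal.tsum_eq_zero.mpr fun T' => indicator_spined_eq_zero _ (by omega)
          (fun hm => (replicate_mem_extend hr h0 c).mp hm hc) T'
      · rw [← add_assoc r, Nat.add_right_comm r s 1,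
          ih (by omega) ((replicate_mem_extend hr h0 c).mpr hc), ballSize_extend, card_level_extend]
        congr 1
        rw [pow_add]
        ring
    simp_rw [hstep]
    rw [tsum_children_marked _ (coeff_heightSeries_succ s), spineSeries_succ]
    have hK : Fintype.card (T.level r) = (T.level r).ncard - 1 + 1 := by
      rw [← Nat.card_eq_fintype_card, Nat.card_coe_set_eq, Nat.sub_add_cancel]
      exact (Set.ncard_pos (T.level_finite r)).mpr ⟨_, replicate_mem_level h0⟩
    rw [hK, pow_succ]
    congr 1
    ring

end Counting

/-! ### The value `X(g_c) = p` and the consistency of the ball masses -/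

section Evaluation

theorem coeff_C_tsum (f : ℕ → ℝ≥0∞) (n : ℕ) :
    coeff n (C (∑' k, f k) : PowerSeries ℝ≥0∞) = ∑' k, coeff n (C (f k) : PowerSeries ℝ≥0∞) := by
  simp only [coeff_C]
  split_ifs <;> simp

/-- The power series identity applied to constants and read off in degree zero. -/
theorem tsum_pow_sum {ι : Type*} [Fintype ι] (z : ℝ≥0∞) :
    ∑' c : ι → ℕ, z ^ ∑ i, c i = (∑' k : ℕ, z ^ k) ^ Fintype.card ι := by
  have h := tsum_children (ι := ι) (y := C z) (G := C (∑' k : ℕ, z ^ k))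
    (fun n => by simp_rw [← map_pow]; exact coeff_C_tsum _ n) 1 0
  simpa only [one_mul, ← map_pow, coeff_zero_C] using h

theorem tsum_pow_sum_marked {ι : Type*} [Fintype ι] (i₀ : ι) (z y : ℝ≥0∞) :
    ∑' c : ι → ℕ, (if c i₀ = 0 then 0 else z ^ (∑ i, c i) * y ^ (∑ i, c i - 1)) =
      z * (∑' k : ℕ, (z * y) ^ k) ^ Fintype.card ι := by
  have h := tsum_children_marked i₀ (z := C z) (y := C y) (G := C (∑' k : ℕ, (z * y) ^ k))
    (fun n => by simp_rw [← map_mul, ← map_pow]; exact coeff_C_tsum _ n) 1 0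
  simpa only [one_mul, ← map_pow, ← map_mul, coeff_zero_C] using h

/-- The value at `x` of the generating function of planar trees of height at most `s`. -/
noncomputable def heightValue (x : ℝ≥0∞) : ℕ → ℝ≥0∞
  | 0 => 1
  | s + 1 => ∑' k : ℕ, (x * heightValue x s) ^ k

variable {T : PlaneTree} {r : ℕ}

theorem card_level (T : PlaneTree) (r : ℕ) : Fintype.card (T.level r) = (T.level r).ncard := by
  rw [← Nat.card_eq_fintype_card, Nat.card_coe_set_eq]

/-- Generation by generation: summing over the children counts of a level turns each vertex's weight
into the geometric series that defines the next `heightValue`. -/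
theorem tsum_heightLE (x : ℝ≥0∞) (hr : 1 ≤ r) (s : ℕ) :
    ∑' T', (T.cylinder r).indicator ({T' : PlaneTree | T'.HeightLE (r + s)}.indicator
        fun T' => x ^ T'.size.toNat) T' =
      x ^ T.ballSize r * heightValue x s ^ (T.level r).ncard := by
  induction s generalizing r T with
  | zero =>
    rw [tsum_indicator_cylinder_of_heightLE hr _ fun T' hT' => Set.indicator_of_notMem hT' _,
      Set.indicator_of_mem (show _ ∈ {T' : PlaneTree | T'.HeightLE (r + 0)} from
        T.heightLE_truncate hr), (T.heightLE_truncate hr).size_eq,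
      ballSize_congr (rootBall_truncate T hr le_rfl)]
    simp [heightValue]
  | succ s ih =>
    rw [tsum_indicator_rootBall hr]
    have hstep : ∀ c : T.level r → ℕ, ∑' T', ((T.extend r hr c).cylinder (r + 1)).indicator
        ({T' : PlaneTree | T'.HeightLE (r + (s + 1))}.indicator fun T' => x ^ T'.size.toNat) T' =
        x ^ T.ballSize r * (x * heightValue x s) ^ ∑ v, c v := fun c => by
      rw [← add_assoc r, Nat.add_right_comm r s 1, ih (by omega), ballSize_extend,
        card_level_extend, pow_add, mul_pow, mul_assoc]
    simp_rw [hstep]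
    rw [ENNReal.tsum_mul_left, tsum_pow_sum, card_level, heightValue]

/-- The tree with a single edge. -/
def singleEdge : PlaneTree where
  verts := {[], [0]}
  root_mem := by simp
  parent_mem v i h := by
    rcases h with h | h
    · simp at h
    · left
      simpa using (List.append_inj' (s₂ := []) (t₂ := [0]) h rfl).1
  sibling_mem v i j h hj := by
    rcases h with h | h
    · simp at h
    · obtain ⟨rfl, h2⟩ := List.append_inj' (s₂ := []) (t₂ := [0]) h rfl
      obtain rfl : i = 0 := by simpa using h2
      obtain rfl : j = 0 := by omega
      right
      rfl
  finite_children v := by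
    refine (Set.finite_singleton 0).subset fun i h => ?_
    rcases h with h | h
    · simp at h
    · simpa using (List.append_inj' (s₂ := []) (t₂ := [0]) h rfl).2
  root_degree_one i := by simp

/-- All roots have degree one, so sums over all trees are instances of sums over a cylinder. -/
theorem cylinder_one (T : PlaneTree) : T.cylinder 1 = Set.univ :=
  Set.eq_univ_of_forall fun T' => rootBall_one T' T

theorem isFinite_iff (T : PlaneTree) : T.IsFinite ↔ ∃ h, T.HeightLE h := by
  constructor
  · intro hT
    obtain ⟨h, hh⟩ := (Set.Finite.image List.length hT).bddAbove
    exact ⟨h, fun v hv => hh ⟨v, hv, rfl⟩⟩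
  · rintro ⟨h, hh⟩
    rw [IsFinite, ← heightLE_iff.mp hh]
    exact T.rootBall_finite h

variable {p q : ℝ}

theorem valueAt_heightSeries_succ (hp : 0 < p) (hpq : p < q) (h1 : p + q = 1) (s : ℕ) :
    valueAt (p * q) (heightSeries ℝ (s + 1)) =
      (1 - p * q * valueAt (p * q) (heightSeries ℝ s))⁻¹ := by
  have hS := summableAt_heightSeries hp hpq h1
  have h := congrArg (valueAt (p * q)) (heightSeries_succ ℝ s)
  have hX := summableAt_X (p * q)
  rw [valueAt_add (summableAt_one _) ((hX.mul (hS s)).mul (hS _)),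
    valueAt_mul (hX.mul (hS s)) (hS _), valueAt_mul hX (hS s), valueAt_one, valueAt_X] at h
  exact eq_inv_of_mul_eq_one_left (by linear_combination h)

theorem heightValue_eq (hp : 0 < p) (hpq : p < q) (h1 : p + q = 1) (s : ℕ) :
    heightValue (ENNReal.ofReal (p * q)) s =
      ENNReal.ofReal (valueAt (p * q) (heightSeries ℝ s)) := by
  have hq : 0 < q := hp.trans hpq
  induction s with
  | zero => rw [heightValue, heightSeries, valueAt_one, ENNReal.ofReal_one]
  | succ s ih =>
    have hlt : p * q * valueAt (p * q) (heightSeries ℝ s) < 1 := by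
      have h := mul_le_mul_of_nonneg_left (valueAt_heightSeries_le hp hpq h1 s)
        (mul_pos hp hq).le
      rw [mul_assoc p q q⁻¹, mul_inv_cancel₀ hq.ne', mul_one] at h
      linarith
    have h0 : 0 ≤ p * q * valueAt (p * q) (heightSeries ℝ s) :=
      mul_nonneg (mul_pos hp hq).le (valueAt_heightSeries_nonneg hp hpq s)
    rw [heightValue, ih, ← ENNReal.ofReal_mul (mul_pos hp hq).le, ENNReal.tsum_geometric,
      valueAt_heightSeries_succ hp hpq h1, ENNReal.ofReal_inv_of_pos (by linarith),
      ENNReal.ofReal_sub _ h0, ENNReal.ofReal_one]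

theorem tsum_size_heightLE (hp : 0 < p) (hpq : p < q) (h1 : p + q = 1) (s : ℕ) :
    ∑' T', {T' : PlaneTree | T'.HeightLE (1 + s)}.indicator
        (fun T' => ENNReal.ofReal (p * q) ^ T'.size.toNat) T' =
      ENNReal.ofReal (p * q * valueAt (p * q) (heightSeries ℝ s)) := by
  have h := tsum_heightLE (T := singleEdge) (ENNReal.ofReal (p * q)) le_rfl s
  rw [cylinder_one, Set.indicator_univ, ballSize_one, card_level_one, pow_one, pow_one,
    heightValue_eq hp hpq h1, ← ENNReal.ofReal_mul (mul_pos hp (hp.trans hpq)).le] at h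
  exact h

/-- Trees of height at most `1 + s` contribute `pq · y_s(pq)`, where the extra `pq` is the root
edge. These heights exhaust the finite trees, and `pq · y_s(pq) → pq/q = p`. -/
theorem tsum_size_isFinite (hp : 0 < p) (hpq : p < q) (h1 : p + q = 1) :
    ∑' T : {T : PlaneTree // T.IsFinite}, ENNReal.ofReal (p * q) ^ T.1.size.toNat =
      ENNReal.ofReal p := by
  have hq : 0 < q := hp.trans hpq
  have hpq0 : 0 ≤ p * q := by positivity
  change ∑' T : {T : PlaneTree | T.IsFinite},
    (fun T : PlaneTree => ENNReal.ofReal (p * q) ^ T.size.toNat) T = _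
  rw [tsum_subtype {T : PlaneTree | T.IsFinite}
    fun T => ENNReal.ofReal (p * q) ^ T.size.toNat]
  refine le_antisymm ?_ ?_
  · rw [ENNReal.tsum_eq_iSup_sum]
    refine iSup_le fun F => ?_
    -- A finite set of finite trees has a common height bound.
    have hF : ∃ s, ∀ T ∈ F, T.IsFinite → T.HeightLE (1 + s) := by
      classical
      induction F using Finset.induction_on with
      | empty => exact ⟨0, by simp⟩
      | insert T F _ ih =>
        obtain ⟨s, hs⟩ := ih
        by_cases hT : T.IsFinite
        · obtain ⟨h, hh⟩ := (isFinite_iff T).mp hT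
          refine ⟨s + h, fun T' hT' hfin => ?_⟩
          rcases Finset.mem_insert.mp hT' with rfl | hT'
          · exact hh.mono (by omega)
          · exact (hs T' hT' hfin).mono (by omega)
        · refine ⟨s, fun T' hT' hfin => ?_⟩
          rcases Finset.mem_insert.mp hT' with rfl | hT'
          · exact absurd hfin hT
          · exact hs T' hT' hfin
    obtain ⟨s, hs⟩ := hF
    calc _ ≤ ∑ T ∈ F, {T' : PlaneTree | T'.HeightLE (1 + s)}.indicator
          (fun T' => ENNReal.ofReal (p * q) ^ T'.size.toNat) T := by
          refine Finset.sum_le_sum fun T hT => ?_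
          by_cases hfin : T.IsFinite
          · rw [Set.indicator_of_mem (show T ∈ {T : PlaneTree | T.IsFinite} from hfin),
              Set.indicator_of_mem (show T ∈ {T' : PlaneTree | T'.HeightLE (1 + s)} from
                hs T hT hfin)]
          · rw [Set.indicator_of_notMem (show T ∉ {T : PlaneTree | T.IsFinite} from hfin)]
            exact zero_le
      _ ≤ _ := ENNReal.sum_le_tsum F
      _ = _ := tsum_size_heightLE hp hpq h1 s
      _ ≤ _ := by
          refine ENNReal.ofReal_le_ofReal ?_
          have h := mul_le_mul_of_nonneg_left (valueAt_heightSeries_le hp hpq h1 s) hpq0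
          rwa [mul_assoc p q q⁻¹, mul_inv_cancel₀ hq.ne', mul_one] at h
  · have hlim : Tendsto (fun s => valueAt (p * q) (heightSeries ℝ s)) atTop (𝓝 q⁻¹) := by
      have h := ((summable_inv_sub_valueAt_pow hp hpq h1 1).tendsto_atTop_zero).const_sub q⁻¹
      simpa using h
    have hlim' := ENNReal.tendsto_ofReal (hlim.const_mul (p * q))
    rw [mul_assoc p q q⁻¹, mul_inv_cancel₀ hq.ne', mul_one] at hlim'
    refine le_of_tendsto' hlim' fun s => ?_
    rw [← tsum_size_heightLE hp hpq h1 s]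
    refine ENNReal.tsum_le_tsum fun T => ?_
    exact Set.indicator_le_indicator_of_subset
      (fun T hT => (isFinite_iff T).mpr ⟨_, hT⟩) (fun _ => zero_le) T

theorem hasSum_treeGF (hp : 0 < p) (hpq : p < q) (h1 : p + q = 1) :
    HasSum (fun T : {T : PlaneTree // T.IsFinite} => (p * q) ^ T.1.size.toNat) p := by
  have h := tsum_size_isFinite hp hpq h1
  have h2 := ENNReal.hasSum_toReal (h ▸ ENNReal.ofReal_ne_top)
  rw [← ENNReal.tsum_toReal_eq fun T => ENNReal.pow_ne_top ENNReal.ofReal_ne_top, h,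
    ENNReal.toReal_ofReal hp.le] at h2
  simpa only [ENNReal.toReal_pow, ENNReal.toReal_ofReal (mul_pos hp (hp.trans hpq)).le] using h2

/-- The mass of a ball of radius `1 / r` around a tree with `n` edges and `K` vertices at
distance `r` from the root. -/
noncomputable def ballMass (p q : ℝ) (r n K : ℕ) : ℝ≥0∞ :=
  ENNReal.ofReal p⁻¹ ^ (r - 1) * ENNReal.ofReal (p * q) ^ (n - 1) *
    ENNReal.ofReal q⁻¹ ^ (K - 1)

/-- The masses are consistent: one generation produces the factor `p⁻¹` from the radius, `pq` from
the forced spine edge, and `∑ (pq · q⁻¹)^k = 1/(1 - p) = 1/q` for each vertex of the level. Since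
`p⁻¹ · pq · q⁻¹ = 1`, the spine vertex's share is one and the other `K - 1` vertices restore
`q^{-(K-1)}`. -/
theorem tsum_ballMass (hp : 0 < p) (hpq : p < q) (h1 : p + q = 1) (hr : 1 ≤ r)
    (h0 : List.replicate r 0 ∈ T.verts) (s : ℕ) :
    ∑' T', (T.cylinder r).indicator ((spined (r + s)).indicator fun T' =>
        ballMass p q (r + s) (T'.ballSize (r + s)) (T'.level (r + s)).ncard) T' =
      ballMass p q r (T.ballSize r) (T.level r).ncard := by
  have hq : 0 < q := hp.trans hpq
  induction s generalizing r T with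
  | zero =>
    rw [tsum_indicator_cylinder_of_heightLE hr _ fun T' hT' =>
      Set.indicator_of_notMem (fun h => hT' h.1) _]
    have hs : T.truncate r hr ∈ spined (r + 0) :=
      ⟨T.heightLE_truncate hr, h0, List.length_replicate.le⟩
    rw [Set.indicator_of_mem hs]
    have h := rootBall_truncate T hr le_rfl
    rw [add_zero, ballSize_congr h, level_eq_of_rootBall_eq h]
  | succ s ih =>
    rw [tsum_indicator_rootBall hr]
    -- Ensures that the truncated subtraction in the exponent `n - 1` commutes with adding the new
    -- edges.
    have hn : T.ballSize r ≠ 0 := by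
      obtain ⟨m, rfl⟩ := Nat.exists_eq_add_of_le' hr
      intro h
      have hc := T.ballSize_add_one (m + 1)
      rw [h, zero_add, eq_comm, Set.ncard_eq_one] at hc
      obtain ⟨v, hv⟩ := hc
      have h1 : [] = v := by
        have := T.nil_mem_rootBall (m + 1)
        rwa [hv] at this
      have h2 : List.replicate (m + 1) 0 = v := by
        have : List.replicate (m + 1) 0 ∈ T.rootBall (m + 1) := ⟨h0, List.length_replicate.le⟩
        rwa [hv] at this
      rw [← h1] at h2
      simp at h2
    have hstep : ∀ c : T.level r → ℕ, ∑' T', ((T.extend r hr c).cylinder (r + 1)).indicator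
        ((spined (r + (s + 1))).indicator fun T' => ballMass p q (r + (s + 1))
          (T'.ballSize (r + (s + 1))) (T'.level (r + (s + 1))).ncard) T' =
        ENNReal.ofReal p⁻¹ ^ r * ENNReal.ofReal (p * q) ^ (T.ballSize r - 1) *
        if c ⟨_, replicate_mem_level h0⟩ = 0 then 0 else
          ENNReal.ofReal (p * q) ^ (∑ v, c v) * ENNReal.ofReal q⁻¹ ^ (∑ v, c v - 1) := fun c => by
      split_ifs with hc
      · rw [mul_zero]
        exact ENNReal.tsum_eq_zero.mpr fun T' => indicator_spined_eq_zero _ (by omega)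
          (fun hm => (replicate_mem_extend hr h0 c).mp hm hc) T'
      · simp_rw [← add_assoc r, Nat.add_right_comm r s 1]
        rw [ih (by omega) ((replicate_mem_extend hr h0 c).mpr hc), ballSize_extend,
          card_level_extend, ballMass, Nat.add_sub_cancel, Nat.sub_add_comm (by omega), pow_add]
        ring
    have hgeom : ∑' k : ℕ, (ENNReal.ofReal (p * q) * ENNReal.ofReal q⁻¹) ^ k =
        ENNReal.ofReal q⁻¹ := by
      rw [← ENNReal.ofReal_mul (by positivity), mul_assoc, mul_inv_cancel₀ hq.ne', mul_one,
        ENNReal.tsum_geometric, ← ENNReal.ofReal_one, ← ENNReal.ofReal_sub _ hp.le,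
        ← ENNReal.ofReal_inv_of_pos (by linarith), ← h1, add_sub_cancel_left]
    have hK : (T.level r).ncard = (T.level r).ncard - 1 + 1 := by
      rw [Nat.sub_add_cancel]
      exact (Set.ncard_pos (T.level_finite r)).mpr ⟨_, replicate_mem_level h0⟩
    have hone : ENNReal.ofReal p⁻¹ * ENNReal.ofReal (p * q) * ENNReal.ofReal q⁻¹ = 1 := by
      rw [← ENNReal.ofReal_mul (by positivity), ← ENNReal.ofReal_mul (by positivity)]
      field_simp
      exact ENNReal.ofReal_one
    simp_rw [hstep]
    rw [ENNReal.tsum_mul_left, tsum_pow_sum_marked, hgeom, card_level, hK, pow_succ, ballMass,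
      Nat.add_sub_cancel]
    obtain ⟨m, rfl⟩ := Nat.exists_eq_add_of_le' hr
    rw [Nat.add_sub_cancel, pow_succ]
    calc _ = ENNReal.ofReal p⁻¹ ^ m * ENNReal.ofReal (p * q) ^ (T.ballSize (m + 1) - 1) *
          ENNReal.ofReal q⁻¹ ^ ((T.level (m + 1)).ncard - 1) *
          (ENNReal.ofReal p⁻¹ * ENNReal.ofReal (p * q) * ENNReal.ofReal q⁻¹) := by ring
      _ = _ := by rw [hone, mul_one]

/-- Consistency starting from the single edge, whose mass is one. This conservation of mass gives
tightness and the infinite spine. -/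
theorem tsum_ballMass_eq_one (hp : 0 < p) (hpq : p < q) (h1 : p + q = 1) (hr : 1 ≤ r) :
    ∑' T, (spined r).indicator (fun T => ballMass p q r (T.ballSize r) (T.level r).ncard) T =
      1 := by
  obtain ⟨s, rfl⟩ := Nat.exists_eq_add_of_le hr
  have h := tsum_ballMass (T := singleEdge) hp hpq h1 le_rfl (Or.inr rfl) s
  rw [cylinder_one, Set.indicator_univ, ballSize_one, card_level_one] at h
  rw [h]
  simp [ballMass]

end Evaluation

/-! ### Left-most paths as words of zeros -/

section OneSided

variable {T : PlaneTree}

theorem replicate_length_le (v : List ℕ) : List.replicate v.length 0 ≤ v := by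
  induction v with
  | nil => exact le_rfl
  | cons b v ih =>
    rw [List.length_cons, List.replicate_succ]
    refine not_lt.mp fun h => ?_
    rcases List.cons_lt_cons_iff.mp h with h | ⟨-, h⟩
    · exact Nat.not_lt_zero _ h
    · exact not_lt.mpr ih h

theorem append_lt_append {a b : ℕ} (v : List ℕ) (h : a < b) : v ++ [a] < v ++ [b] := by
  induction v with
  | nil => exact List.cons_lt_cons_iff.mpr (Or.inl h)
  | cons c v ih => exact List.cons_lt_cons_iff.mpr (Or.inr ⟨rfl, ih⟩)

/-- If `v ++ [i]` is a vertex, so is `v ++ [0]`, which precedes it lexicographically unless `i = 0`.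
A left-most path therefore always turns to child `0`; conversely a word of zeros is least among
words of its length. -/
theorem exists_isLeftmostPath_iff (T : PlaneTree) (n : ℕ) :
    (∃ p, T.IsLeftmostPath n p) ↔ List.replicate n 0 ∈ T.verts := by
  constructor
  · rintro ⟨p, hp, hmin⟩
    have h : ∀ k ≤ n, p k = List.replicate k 0 := by
      intro k
      induction k with
      | zero => exact fun hk => List.length_eq_zero_iff.mp (hmin 0 hk).1.2
      | succ k ih =>
        intro hk
        obtain ⟨i, hi⟩ := hp k hk
        have hmem := (hmin (k + 1) hk).1
        have h0 : p k ++ [0] ∈ T.level (k + 1) := by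
          rw [hi] at hmem
          exact ⟨T.sibling_mem _ i 0 hmem.1 (Nat.zero_le i), by simpa using hmem.2⟩
        have hle := (hmin (k + 1) hk).2 h0
        rw [hi] at hle
        obtain rfl : i = 0 := by
          by_contra hne
          exact not_lt.mpr hle (append_lt_append _ (Nat.pos_of_ne_zero hne))
        rw [hi, ih (by omega), List.replicate_succ']
    rw [← h n le_rfl]
    exact (hmin n le_rfl).1.1
  · intro h
    refine ⟨fun k => List.replicate k 0, fun k _ => ⟨0, List.replicate_succ'⟩, fun k hk =>
      ⟨replicate_mem_level (replicate_mem_of_le hk h), fun v hv => ?_⟩⟩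
    rw [← hv.2]
    exact replicate_length_le v

theorem le_leftmostLength_iff (T : PlaneTree) (n : ℕ) :
    (n : ℕ∞) ≤ T.leftmostLength ↔ List.replicate n 0 ∈ T.verts := by
  have hset : {n : ℕ | ∃ p : ℕ → List ℕ, T.IsLeftmostPath n p} =
      {n : ℕ | List.replicate n 0 ∈ T.verts} := Set.ext T.exists_isLeftmostPath_iff
  rw [leftmostLength, hset]
  constructor
  · intro h
    by_contra hn
    cases n with
    | zero => exact hn T.root_mem
    | succ n =>
      have hle : (⨆ m ∈ {m : ℕ | List.replicate m 0 ∈ T.verts}, (m : ℕ∞)) ≤ n := by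
        refine iSup₂_le fun m hm => ?_
        by_contra hlt
        have : n + 1 ≤ m := by
          rw [not_le] at hlt
          exact_mod_cast hlt
        exact hn (replicate_mem_of_le this hm)
      have := h.trans hle
      have : n + 1 ≤ n := by exact_mod_cast this
      omega
  · exact fun h => le_iSup₂ (f := fun (m : ℕ) (_ : m ∈ {m : ℕ | List.replicate m 0 ∈ T.verts}) =>
      (m : ℕ∞)) n h

theorem leftmostLength_eq_top_iff (T : PlaneTree) :
    T.leftmostLength = ⊤ ↔ ∀ n, List.replicate n 0 ∈ T.verts := by
  simp_rw [← le_leftmostLength_iff]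
  exact ENat.eq_top_iff_forall_ge

theorem height_le_iff (h : ℕ) : T.height ≤ h ↔ T.HeightLE h := by
  unfold height
  split_ifs with hT
  · simp [HeightLE]
  · simp only [top_le_iff, ENat.natCast_ne_top, false_iff]
    exact fun H => hT ((isFinite_iff T).mpr ⟨h, H⟩)

theorem mem_spined_iff (h : ℕ) :
    T ∈ spined h ↔ T.IsOneSided ∧ T.height = h := by
  constructor
  · rintro ⟨hle, hm⟩
    have h1 : T.height ≤ h := (height_le_iff h).mpr hle
    have h2 : (h : ℕ∞) ≤ T.leftmostLength := (le_leftmostLength_iff T h).mpr hm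
    have h3 : (h : ℕ∞) ≤ T.height := by
      have hT : T.IsFinite := (isFinite_iff T).mpr ⟨h, hle⟩
      rw [height, if_pos hT]
      simpa using le_iSup₂ (f := fun (v : List ℕ) (_ : v ∈ T.verts) => (v.length : ℕ∞)) _ hm
    have h4 : T.leftmostLength ≤ h := by
      by_contra hlt
      rw [not_le] at hlt
      have : ((h + 1 : ℕ) : ℕ∞) ≤ T.leftmostLength := by
        push_cast
        exact Order.add_one_le_of_lt hlt
      have := hle _ ((le_leftmostLength_iff T _).mp this)
      simp at this
    have h5 := le_antisymm h1 h3
    exact ⟨(le_antisymm h4 h2).trans h5.symm, h5⟩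
  · rintro ⟨h1, h2⟩
    refine ⟨(height_le_iff h).mp h2.le, (le_leftmostLength_iff T h).mp ?_⟩
    rw [h1, h2]

theorem spined_isFinite {h : ℕ} (hT : T ∈ spined h) : T.IsFinite :=
  (isFinite_iff T).mpr ⟨h, hT.1⟩

/-- For an infinite tree the height is `⊤`, so one-sidedness means a spine of every length, and such
a spine already makes the tree infinite. -/
theorem mem_infiniteOneSided_iff :
    T ∈ infiniteOneSided ↔ ∀ n, List.replicate n 0 ∈ T.verts := by
  rw [← leftmostLength_eq_top_iff]
  constructor
  · rintro ⟨h1, h2⟩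
    rw [h1, height, if_neg h2]
  · intro h
    have h2 : ¬ T.IsFinite := fun hT => by
      obtain ⟨k, hk⟩ := (isFinite_iff T).mp hT
      have := hk _ ((leftmostLength_eq_top_iff T).mp h (k + 1))
      simp at this
    exact ⟨by rw [IsOneSided, h, height, if_neg h2], h2⟩

theorem isFinite_of_size_eq {N : ℕ} (h : T.size = N) : T.IsFinite := by
  have h1 : (T.verts \ {[]}).Finite := by
    rw [← Set.encard_ne_top_iff, ← size_eq_encard, h]
    exact ENat.natCast_ne_top N
  exact (h1.union (Set.finite_singleton [])).subset fun v hv => by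
    by_cases hv' : v = []
    · exact Or.inr hv'
    · exact Or.inl ⟨hv, hv'⟩

theorem mem_oneSided_iff {N : ℕ} :
    T ∈ oneSided N ↔ T.size = N ∧ ∃ h : ℕ, T ∈ spined h := by
  constructor
  · rintro ⟨h1, h2⟩
    obtain ⟨k, hk⟩ := (isFinite_iff T).mp (isFinite_of_size_eq h2)
    have hle := (height_le_iff k).mpr hk
    lift T.height to ℕ using ne_top_of_le_ne_top (ENat.natCast_ne_top k) hle with h hh
    exact ⟨h2, h, (mem_spined_iff h).mpr ⟨h1, hh.symm⟩⟩
  · rintro ⟨h1, h, hh⟩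
    exact ⟨((mem_spined_iff h).mp hh).1, h1⟩

theorem eq_of_mem_spined {h h' : ℕ} (hT : T ∈ spined h) (hT' : T ∈ spined h') : h = h' := by
  have := ((mem_spined_iff h).mp hT).2.symm.trans ((mem_spined_iff h').mp hT').2
  exact_mod_cast this

theorem truncate_mem_spined {r : ℕ} (hr : 1 ≤ r) (h0 : List.replicate r 0 ∈ T.verts) :
    T.truncate r hr ∈ spined r := ⟨T.heightLE_truncate hr, h0, List.length_replicate.le⟩

end OneSided

/-! ### Finite-size measures of cylinders and their limits -/

section Weights

open PowerSeries

variable {T : PlaneTree} {r : ℕ} {μ : ℝ}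

/-- The total weight of the one-sided trees of size `N` with a given ball. -/
noncomputable def cylinderWeight (μ : ℝ) (N : ℕ) (S : Set PlaneTree) : ℝ≥0∞ :=
  ∑' T, S.indicator ((oneSided N).indicator
    fun T => ENNReal.ofReal (Real.exp (-μ * (T.height.toNat : ℝ)))) T

theorem finiteSizeMeasure_apply (μ : ℝ) (N : ℕ) {S : Set PlaneTree} (hS : MeasurableSet S) :
    finiteSizeMeasure μ N S = cylinderWeight μ N S / partitionFn μ N := by
  rw [finiteSizeMeasure, Measure.sum_apply _ hS, cylinderWeight, div_eq_mul_inv,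
    ← ENNReal.tsum_mul_right]
  simp only [Measure.smul_apply, Measure.dirac_apply' _ hS, smul_eq_mul]
  rw [tsum_subtype (oneSided N) fun T => ENNReal.ofReal (Real.exp (-μ * (T.height.toNat : ℝ))) /
    partitionFn μ N * S.indicator 1 T]
  refine tsum_congr fun T => ?_
  by_cases h1 : T ∈ S <;> by_cases h2 : T ∈ oneSided N <;> simp [h1, h2, div_eq_mul_inv]

/-- A one-sided tree of size `N` lies in exactly one `spined h`, namely for its own height. -/
theorem indicator_oneSided (μ : ℝ) (N : ℕ) (T : PlaneTree) :
    (oneSided N).indicator (fun T => ENNReal.ofReal (Real.exp (-μ * (T.height.toNat : ℝ)))) T =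
      ∑' h : ℕ, ENNReal.ofReal (Real.exp (-μ * h)) *
        (spined h).indicator ({T : PlaneTree | T.size = (N : ℕ∞)}.indicator 1) T := by
  by_cases hT : T ∈ oneSided N
  · obtain ⟨hN, h, hh⟩ := mem_oneSided_iff.mp hT
    rw [Set.indicator_of_mem hT, tsum_eq_single h, Set.indicator_of_mem hh, Set.indicator_of_mem
      (show T ∈ {T : PlaneTree | T.size = (N : ℕ∞)} from hN), ((mem_spined_iff h).mp hh).2]
    · simp
    · intro h' hh'
      rw [Set.indicator_of_notMem fun hm => hh' (eq_of_mem_spined hm hh), mul_zero]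
  · rw [Set.indicator_of_notMem hT, eq_comm, ENNReal.tsum_eq_zero]
    intro h
    rw [mul_eq_zero]
    right
    by_cases hh : T ∈ spined h
    · rw [Set.indicator_of_mem hh, Set.indicator_of_notMem]
      exact fun hN => hT (mem_oneSided_iff.mpr ⟨hN, h, hh⟩)
    · exact Set.indicator_of_notMem hh _

theorem coeff_X_pow_mul_ballCount (n N k s : ℕ) :
    coeff N (X ^ n * (heightSeries ℝ≥0∞ s ^ k * spineSeries ℝ≥0∞ s)) =
      if n ≤ N then (ballCount k s (N - n) : ℝ≥0∞) else 0 := by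
  rw [coeff_X_pow_mul', cast_ballCount]

theorem tsum_spined_size_cylinder (hr : 1 ≤ r) (h0 : List.replicate r 0 ∈ T.verts) (s N : ℕ) :
    ∑' T', (T.cylinder r).indicator ((spined (r + s)).indicator
        ({T' : PlaneTree | T'.size = (N : ℕ∞)}.indicator 1)) T' =
      if T.ballSize r ≤ N then
        (ballCount ((T.level r).ncard - 1) s (N - T.ballSize r) : ℝ≥0∞) else 0 := by
  rw [tsum_spined_size hr h0, coeff_X_pow_mul_ballCount]

theorem cylinderWeight_cylinder (hr : 1 ≤ r) (h0 : List.replicate r 0 ∈ T.verts) (μ : ℝ)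
    (N : ℕ) : cylinderWeight μ N (T.cylinder r) =
      ∑' s : ℕ, ENNReal.ofReal (Real.exp (-μ * (r + s : ℕ))) *
        if T.ballSize r ≤ N then
          (ballCount ((T.level r).ncard - 1) s (N - T.ballSize r) : ℝ≥0∞) else 0 := by
  have h1 : cylinderWeight μ N (T.cylinder r) = ∑' h : ℕ, ENNReal.ofReal (Real.exp (-μ * h)) *
      ∑' T', (T.cylinder r).indicator ((spined h).indicator
        ({T' : PlaneTree | T'.size = (N : ℕ∞)}.indicator 1)) T' := by
    simp_rw [← ENNReal.tsum_mul_left]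
    rw [ENNReal.tsum_comm, cylinderWeight]
    refine tsum_congr fun T' => ?_
    by_cases hT' : T' ∈ T.cylinder r
    · simp only [Set.indicator_of_mem hT']
      exact indicator_oneSided μ N T'
    · simp [Set.indicator_of_notMem hT']
  -- A ball containing a spine of length `r` forces height at least `r`, so the sum over heights may
  -- start at `r`.
  have h2 : ∀ h ∈ Finset.range r, ENNReal.ofReal (Real.exp (-μ * h)) *
      ∑' T', (T.cylinder r).indicator ((spined h).indicator
        ({T' : PlaneTree | T'.size = (N : ℕ∞)}.indicator 1)) T' = 0 := fun h hh => by
    rw [mul_eq_zero, ENNReal.tsum_eq_zero]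
    right
    intro T'
    rw [Set.indicator_apply_eq_zero]
    intro hT'
    refine Set.indicator_of_notMem (fun hs => ?_) _
    have hle := hs.1 _ ((mem_verts_iff_of_rootBall_eq hT' List.length_replicate.le).mpr h0)
    rw [List.length_replicate] at hle
    exact absurd (Finset.mem_range.mp hh) (not_lt.mpr hle)
  rw [h1, ← ENNReal.summable.sum_add_tsum_nat_add' (k := r), Finset.sum_eq_zero h2, zero_add]
  refine tsum_congr fun s => ?_
  rw [add_comm s r, tsum_spined_size_cylinder hr h0]

/-- The cylinder of radius one is the whole space, so the partition function is itself a cylinder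
weight. -/
theorem partitionFn_eq (μ : ℝ) (N : ℕ) :
    partitionFn μ N = cylinderWeight μ N (singleEdge.cylinder 1) := by
  rw [cylinderWeight_cylinder (T := singleEdge) le_rfl (Or.inr rfl), partitionFn]
  refine tsum_congr fun s => ?_
  rw [add_comm s 1, ← tsum_spined_size_cylinder (T := singleEdge) le_rfl (Or.inr rfl)]
  congr 1
  rw [numOneSided, ← ENNReal.tsum_set_one, tsum_subtype _ fun _ => (1 : ℝ≥0∞), cylinder_one,
    Set.indicator_univ]
  refine tsum_congr fun T => ?_
  rw [Set.indicator_indicator]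
  congr 1
  ext T
  simp only [Set.mem_ofPred_eq, Set.mem_inter_iff, mem_spined_iff, oneSided]
  tauto

theorem cylinderWeight_add (hr : 1 ≤ r) (h0 : List.replicate r 0 ∈ T.verts) (μ : ℝ) (N : ℕ) :
    cylinderWeight μ (T.ballSize r + N) (T.cylinder r) =
      ENNReal.ofReal (Real.exp (-μ) ^ r * ∑ s ∈ Finset.range (N + 1),
        Real.exp (-μ) ^ s * (ballCount ((T.level r).ncard - 1) s N : ℝ)) := by
  rw [cylinderWeight_cylinder hr h0, tsum_eq_sum (s := Finset.range (N + 1)), Finset.mul_sum,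
    ENNReal.ofReal_sum_of_nonneg fun s _ => by positivity]
  · refine Finset.sum_congr rfl fun s _ => ?_
    rw [if_pos (Nat.le_add_right _ _), Nat.add_sub_cancel_left, ← mul_assoc, ← pow_add,
      ENNReal.ofReal_mul (by positivity), ENNReal.ofReal_natCast, ← Real.exp_nat_mul,
      mul_comm ((r + s : ℕ) : ℝ)]
  · intro s hs
    rw [if_pos (Nat.le_add_right _ _), Nat.add_sub_cancel_left, ballCount_of_lt, Nat.cast_zero,
      mul_zero]
    simpa [Nat.lt_succ_iff] using hs

theorem partitionFn_add (μ : ℝ) (N : ℕ) :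
    partitionFn μ (1 + N) = ENNReal.ofReal (Real.exp (-μ) * ∑ s ∈ Finset.range (N + 1),
      Real.exp (-μ) ^ s * (ballCount 0 s N : ℝ)) := by
  have h := cylinderWeight_add (T := singleEdge) le_rfl (Or.inr rfl) μ N
  rwa [ballSize_one, card_level_one, ← partitionFn_eq, pow_one] at h

theorem sum_ballCount_pos (μ : ℝ) (N : ℕ) :
    0 < ∑ s ∈ Finset.range (N + 1), Real.exp (-μ) ^ s * (ballCount 0 s N : ℝ) := by
  have key : ∃ s ∈ Finset.range (N + 1), 0 < ballCount 0 s N := by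
    -- The path is the one-sided tree with height equal to its size.
    refine ⟨N, by simp, ?_⟩
    have h : constantCoeff (∏ j ∈ Finset.range N, heightSeries ℕ (j + 1)) = 1 := by
      rw [map_prod]
      refine Finset.prod_eq_one fun j _ => ?_
      rw [heightSeries_succ]
      simp
    rw [ballCount, pow_zero, one_mul, spineSeries, coeff_X_pow_mul', if_pos le_rfl, Nat.sub_self,
      coeff_zero_eq_constantCoeff_apply, h]
    exact one_pos
  obtain ⟨s, hs, hpos⟩ := key
  refine Finset.sum_pos' (fun s _ => by positivity) ⟨s, hs, ?_⟩
  have : (0 : ℝ) < ballCount 0 s N := by exact_mod_cast hpos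
  positivity

theorem isProbabilityMeasure_finiteSizeMeasure (μ : ℝ) {N : ℕ} (hN : 1 ≤ N) :
    IsProbabilityMeasure (finiteSizeMeasure μ N) := by
  obtain ⟨N, rfl⟩ := Nat.exists_eq_add_of_le hN
  constructor
  rw [finiteSizeMeasure_apply μ _ MeasurableSet.univ, ← cylinder_one singleEdge, ← partitionFn_eq,
    partitionFn_add]
  refine ENNReal.div_self ?_ ENNReal.ofReal_ne_top
  rw [Ne, ENNReal.ofReal_eq_zero, not_le]
  exact mul_pos (Real.exp_pos _) (sum_ballCount_pos μ N)

/-- The masses of the cylinders around trees with a left-most path converge. -/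
theorem tendsto_finiteSizeMeasure_cylinder {p q : ℝ} (hp : 0 < p) (hpq : p < q) (h1 : p + q = 1)
    (hμ : Real.exp (-μ) = p⁻¹) (hr : 1 ≤ r) (h0 : List.replicate r 0 ∈ T.verts)
    (hm : MeasurableSet (T.cylinder r)) :
    Tendsto (fun N => finiteSizeMeasure μ N (T.cylinder r)) atTop
      (𝓝 (ballMass p q r (T.ballSize r) (T.level r).ncard)) := by
  have hq : 0 < q := hp.trans hpq
  obtain ⟨L, hL, hlim⟩ := exists_tendsto_ballCount hp hpq h1
  set n := T.ballSize r with hn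
  set k := (T.level r).ncard - 1 with hk
  have hn1 : 1 ≤ n := by
    obtain ⟨m, rfl⟩ := Nat.exists_eq_add_of_le' hr
    rw [hn, ballSize_succ]
    have : 0 < (T.level (m + 1)).ncard :=
      (Set.ncard_pos (T.level_finite _)).mpr ⟨_, replicate_mem_level h0⟩
    omega
  obtain ⟨n', hn'⟩ := Nat.exists_eq_add_of_le hn1
  rw [← tendsto_add_atTop_iff_nat n]
  -- At total size `N + n` the numerator counts `N` edges outside the ball and the denominator `n -
  -- 1 + N` edges beyond the root edge. Multiplying both by `(pq)^(n' + N)`, with `n' = n - 1`,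
  -- makes each converge and leaves `(pq)^(n-1)` in the numerator.
  have heq : ∀ N, finiteSizeMeasure μ (N + n) (T.cylinder r) = ENNReal.ofReal
      (p⁻¹ ^ r * (p * q) ^ n' * ((∑ s ∈ Finset.range (N + 1),
        p⁻¹ ^ s * (ballCount k s N : ℝ)) * (p * q) ^ N) /
      (p⁻¹ * ((∑ s ∈ Finset.range (n' + N + 1), p⁻¹ ^ s * (ballCount 0 s (n' + N) : ℝ)) *
        (p * q) ^ (n' + N)))) := fun N => by
    rw [finiteSizeMeasure_apply μ _ hm, add_comm N n, hn, cylinderWeight_add hr h0, ← hn, ← hk, hn',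
      add_assoc, partitionFn_add, hμ, ← ENNReal.ofReal_div_of_pos]
    · have hpos := (hμ ▸ sum_ballCount_pos μ (n' + N)).ne'
      congr 1
      rw [pow_add (p * q) n' N]
      field_simp
    · have := sum_ballCount_pos μ (n' + N)
      rw [hμ] at this
      positivity
  simp_rw [heq]
  have hden := (hlim 0).comp (tendsto_add_atTop_nat n')
  rw [pow_zero, mul_one] at hden
  have hfrac := ((hlim k).const_mul (p⁻¹ ^ r * (p * q) ^ n')).div (hden.const_mul p⁻¹)
    (by positivity)
  have h := ENNReal.tendsto_ofReal hfrac
  have hval : ENNReal.ofReal (p⁻¹ ^ r * (p * q) ^ n' * (L * q⁻¹ ^ k) / (p⁻¹ * L)) =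
      ballMass p q r n (T.level r).ncard := by
    rw [ballMass, ← ENNReal.ofReal_pow (by positivity), ← ENNReal.ofReal_pow (by positivity),
      ← ENNReal.ofReal_pow (by positivity), ← ENNReal.ofReal_mul (by positivity),
      ← ENNReal.ofReal_mul (by positivity), hn', Nat.add_sub_cancel_left, ← hk]
    obtain ⟨m, rfl⟩ := Nat.exists_eq_add_of_le' hr
    rw [Nat.add_sub_cancel, pow_succ]
    congr 1
    field_simp
  rw [hval] at h
  refine h.congr fun N => ?_
  simp only [Pi.div_apply, Function.comp_apply, add_comm n' N]

end Weights

/-! ### The local topology: clopen cylinders, completeness, compact sets -/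

section Topology

variable {T T' : PlaneTree} {r : ℕ}

theorem dist_le_iff (hr : 1 ≤ r) :
    dist T T' ≤ 1 / (r : ℝ) ↔ T.rootBall r = T'.rootBall r := by
  constructor
  · intro h
    have hr' : (1 : ℝ) ≤ r := by exact_mod_cast hr
    -- The half-integer gives a strict inequality, and any integer radius `s > r - 1/2` satisfies `s
    -- ≥ r`.
    have hlt : dist T T' < 1 / ((r : ℝ) - 1 / 2) :=
      h.trans_lt (one_div_lt_one_div_of_lt (by linarith) (by linarith))
    rw [dist_def] at hlt
    obtain ⟨_, ⟨s, hs1, hs, rfl⟩, hsr⟩ := exists_lt_of_csInf_lt (agreeRadii_nonempty _ _) hlt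
    have hs' : (1 : ℝ) ≤ s := by exact_mod_cast hs1
    have h2 := (one_div_lt_one_div (by linarith) (by linarith)).mp hsr
    refine rootBall_mono ?_ hs
    have h3 : (r : ℝ) < s + 1 := by linarith
    have h4 : r < s + 1 := by exact_mod_cast h3
    omega
  · exact fun h => csInf_le (agreeRadii_bddBelow _ _) ⟨r, hr, h, rfl⟩

theorem closedBall_eq_cylinder (T : PlaneTree) (hr : 1 ≤ r) :
    Metric.closedBall T (1 / (r : ℝ)) = T.cylinder r :=
  Set.ext fun _ => dist_le_iff hr

theorem cylinder_mono {s : ℕ} (T : PlaneTree) (h : r ≤ s) : T.cylinder s ⊆ T.cylinder r :=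
  fun _ => rootBall_mono h

theorem mem_cylinder_self (T : PlaneTree) (r : ℕ) : T ∈ T.cylinder r := rfl

theorem cylinder_congr (h : T' ∈ T.cylinder r) : T'.cylinder r = T.cylinder r := by
  rw [mem_cylinder] at h
  rw [cylinder, cylinder, h]

theorem exists_cylinder_subset_ball (T : PlaneTree) {ε : ℝ} (hε : 0 < ε) :
    ∃ r : ℕ, 1 ≤ r ∧ T.cylinder r ⊆ Metric.ball T ε := by
  obtain ⟨n, hn⟩ := exists_nat_one_div_lt hε
  refine ⟨n + 1, by omega, fun T' hT' => ?_⟩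
  have h := (dist_le_iff (by omega)).mpr hT'
  push_cast at h
  exact h.trans_lt hn

/-- A cylinder is the closed ball around each of its points. Having empty boundary, it is a
continuity set for every measure. -/
theorem isClopen_cylinder (T : PlaneTree) (hr : 1 ≤ r) : IsClopen (T.cylinder r) := by
  refine ⟨closedBall_eq_cylinder T hr ▸ Metric.isClosed_closedBall,
    Metric.isOpen_iff.mpr fun T' hT' => ⟨1 / (r : ℝ), by positivity, ?_⟩⟩
  rw [← cylinder_congr hT', ← closedBall_eq_cylinder T' hr]
  exact Metric.ball_subset_closedBall

theorem measurableSet_cylinder (T : PlaneTree) (hr : 1 ≤ r) : MeasurableSet (T.cylinder r) :=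
  (isClopen_cylinder T hr).isOpen.measurableSet

/-- The sets `{T' | B_r(T') = B_r(T)}` with `r ≥ 1`. -/
def cylinders : Set (Set PlaneTree) := {S | ∃ (T : PlaneTree) (r : ℕ), 1 ≤ r ∧ S = T.cylinder r}

theorem isTopologicalBasis_cylinders : TopologicalSpace.IsTopologicalBasis cylinders := by
  refine TopologicalSpace.isTopologicalBasis_of_isOpen_of_nhds ?_ ?_
  · rintro _ ⟨T, r, hr, rfl⟩
    exact (isClopen_cylinder T hr).isOpen
  · intro T U hT hU
    obtain ⟨ε, hε, hεU⟩ := Metric.isOpen_iff.mp hU T hT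
    obtain ⟨r, hr, hrε⟩ := T.exists_cylinder_subset_ball hε
    exact ⟨_, ⟨T, r, hr, rfl⟩, T.mem_cylinder_self r, hrε.trans hεU⟩

/-- A cylinder is determined by its radius and a finite set of words. -/
theorem countable_cylinders : cylinders.Countable := by
  have h : cylinders ⊆ Set.range fun x : Finset (List ℕ) × ℕ =>
      {T' : PlaneTree | T'.rootBall x.2 = x.1} := by
    rintro _ ⟨T, r, -, rfl⟩
    exact ⟨((T.rootBall_finite r).toFinset, r), by simp [cylinder]⟩
  exact (Set.countable_range _).mono h

instance : SecondCountableTopology PlaneTree :=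
  isTopologicalBasis_cylinders.secondCountableTopology countable_cylinders

theorem isPiSystem_cylinders : IsPiSystem cylinders := by
  rintro _ ⟨T₁, r, hr, rfl⟩ _ ⟨T₂, s, hs, rfl⟩ ⟨T, h1, h2⟩
  rw [← cylinder_congr h1, ← cylinder_congr h2]
  rcases le_total r s with h | h
  · exact ⟨T, s, hs, Set.inter_eq_self_of_subset_right (T.cylinder_mono h)⟩
  · exact ⟨T, r, hr, Set.inter_eq_self_of_subset_left (T.cylinder_mono h)⟩

theorem borel_eq_generateFrom_cylinders :
    (inferInstance : MeasurableSpace PlaneTree) = MeasurableSpace.generateFrom cylinders :=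
  isTopologicalBasis_cylinders.borel_eq_generateFrom

/-- The tree determined by a coherent sequence of balls. -/
theorem exists_rootBall_eq (u : ℕ → PlaneTree)
    (hu : ∀ r s, 1 ≤ r → r ≤ s → (u s).rootBall r = (u r).rootBall r) :
    ∃ T : PlaneTree, ∀ r, 1 ≤ r → T.rootBall r = (u r).rootBall r := by
  have key : ∀ (r : ℕ) (v : List ℕ), 1 ≤ r → v.length ≤ r →
      (v ∈ (u (v.length + 1)).verts ↔ v ∈ (u r).verts) := fun r v hr hv => by
    rcases Nat.lt_or_ge v.length r with h | h
    · exact (mem_verts_iff_of_rootBall_eq (hu (v.length + 1) r (by omega) h)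
        (Nat.le_succ _)).symm
    · exact mem_verts_iff_of_rootBall_eq (hu r (v.length + 1) hr (by omega)) hv
  have key' : ∀ (v : List ℕ) (i : ℕ), (v ++ [i] ∈ (u ((v ++ [i]).length + 1)).verts ↔
      v ++ [i] ∈ (u (v.length + 1)).verts) := fun v i => key _ _ (by omega) (by simp)
  let T : PlaneTree :=
    -- The index `v.length + 1` is at least one and is deep enough to see the children of `v` as
    -- well.
    { verts := {v | v ∈ (u (v.length + 1)).verts}
      root_mem := (u _).root_mem
      parent_mem := fun v i h => (u _).parent_mem v i ((key' v i).mp h)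
      sibling_mem := fun v i j h hj => (key' v j).mpr
        ((u _).sibling_mem v i j ((key' v i).mp h) hj)
      finite_children := fun v => ((u (v.length + 1)).finite_children v).subset
        fun i h => (key' v i).mp h
      root_degree_one := fun i => (u _).root_degree_one i }
  refine ⟨T, fun r hr => Set.ext fun v => ⟨fun h => ⟨(key r v hr h.2).mp h.1, h.2⟩,
    fun h => ⟨(key r v hr h.2).mpr h.1, h.2⟩⟩⟩

instance : CompleteSpace PlaneTree := by
  refine Metric.complete_of_convergent_controlled_sequences (fun n => 1 / ((n : ℝ) + 1))
    (fun n => by positivity) fun u hu => ?_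
  have hdist : ∀ r s, r ≤ s → (u s).rootBall (r + 1) = (u r).rootBall (r + 1) := fun r s h => by
    rw [← dist_le_iff (by omega)]
    push_cast
    exact (hu r s r h le_rfl).le
  obtain ⟨T, hT⟩ := exists_rootBall_eq u fun r s hr h => by
    obtain ⟨r, rfl⟩ := Nat.exists_eq_add_of_le' hr
    exact (rootBall_mono (Nat.le_succ _) (hdist (r + 1) s h))
  refine ⟨T, Metric.tendsto_atTop.mpr fun ε hε => ?_⟩
  obtain ⟨r, hr, hrε⟩ := T.exists_cylinder_subset_ball hε
  refine ⟨r, fun s hs => hrε ?_⟩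
  rw [mem_cylinder, hT r hr]
  exact rootBall_mono (Nat.le_succ _) (hdist r s hs)

/-- Finitely many possible balls at each radius give total boundedness. The set is closed because
each condition depends only on a ball, and the space is complete. -/
theorem isCompact_setOf_rootBall_mem {A : ℕ → Set (Set (List ℕ))} (hA : ∀ r, (A r).Finite) :
    IsCompact {T : PlaneTree | ∀ r, T.rootBall (r + 1) ∈ A r} := by
  refine TotallyBounded.isCompact_of_isClosed ?_ ?_
  · refine Metric.totallyBounded_of_finite_discretization fun ε hε => ?_
    obtain ⟨n, hn⟩ := exists_nat_one_div_lt hε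
    refine ⟨A n, (hA n).fintype, fun T => ⟨T.1.rootBall (n + 1), T.2 n⟩, fun T T' h => ?_⟩
    have h' := (dist_le_iff (by omega)).mpr (congrArg Subtype.val h)
    push_cast at h'
    exact h'.trans_lt hn
  · rw [Set.ofPred_forall]
    refine isClosed_iInter fun r => ⟨isOpen_iff_mem_nhds.mpr fun T hT => ?_⟩
    refine mem_of_superset ((isClopen_cylinder T (r := r + 1) (by omega)).isOpen.mem_nhds
      (T.mem_cylinder_self _)) fun T' hT' hmem => hT ?_
    rw [Set.mem_ofPred_eq] at hmem ⊢
    rwa [← mem_cylinder.mp hT']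

theorem _root_.IsCompact.finite_image_rootBall {K : Set PlaneTree} (hK : IsCompact K)
    (hr : 1 ≤ r) : ((fun T : PlaneTree => T.rootBall r) '' K).Finite := by
  obtain ⟨F, -, hF⟩ := hK.elim_nhds_subcover (fun T => T.cylinder r) fun T _ =>
    (isClopen_cylinder T hr).isOpen.mem_nhds (T.mem_cylinder_self r)
  refine (F.finite_toSet.image fun T : PlaneTree => T.rootBall r).subset ?_
  rintro _ ⟨T, hT, rfl⟩
  obtain ⟨T', hT', h⟩ := Set.mem_iUnion₂.mp (hF hT)
  exact ⟨T', hT', (mem_cylinder.mp h).symm⟩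

end Topology

/-! ### The ball masses determine the measure -/

section Uniqueness

variable {T : PlaneTree} {r : ℕ} {p q : ℝ}

/-- The balls around one-sided trees of height `r` have the masses `ballMass`. -/
def HasBallMasses (p q : ℝ) (τ : Measure PlaneTree) : Prop :=
  ∀ (r : ℕ) (T : PlaneTree), 1 ≤ r → T ∈ spined r →
    τ (T.cylinder r) = ballMass p q r (T.ballSize r) (T.level r).ncard

theorem eq_of_mem_spined_of_mem_cylinder {T' : PlaneTree} (hT : T ∈ spined r)
    (hT' : T' ∈ spined r) (h : T' ∈ T.cylinder r) : T' = T :=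
  PlaneTree.ext (by rw [← heightLE_iff.mp hT.1, ← heightLE_iff.mp hT'.1, mem_cylinder.mp h])

theorem pairwiseDisjoint_cylinder (r : ℕ) :
    (spined r).PairwiseDisjoint fun T => T.cylinder r := by
  intro T hT T' hT' hne
  refine Set.disjoint_left.mpr fun S h h' => hne ?_
  refine eq_of_mem_spined_of_mem_cylinder hT' hT ?_
  rw [mem_cylinder, ← mem_cylinder.mp h, mem_cylinder.mp h']

theorem countable_spined (r : ℕ) : (spined r).Countable := by
  refine Set.MapsTo.countable_of_injOn (f := fun T => (T.rootBall_finite r).toFinset)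
    (t := Set.univ) (Set.mapsTo_univ _ _) (fun T hT T' hT' h => ?_) (Set.to_countable _)
  exact eq_of_mem_spined_of_mem_cylinder hT' hT (Set.Finite.toFinset_inj.mp h)

/-- The trees whose left-most path has length at least `r`. -/
def longSpine (r : ℕ) : Set PlaneTree := {T | List.replicate r 0 ∈ T.verts}

theorem longSpine_eq_biUnion (hr : 1 ≤ r) : longSpine r = ⋃ T ∈ spined r, T.cylinder r := by
  ext T
  simp only [Set.mem_iUnion₂, exists_prop]
  constructor
  · exact fun h => ⟨T.truncate r hr, truncate_mem_spined hr h,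
      (rootBall_truncate T hr le_rfl).symm⟩
  · rintro ⟨T', hT', h⟩
    exact (mem_verts_iff_of_rootBall_eq h List.length_replicate.le).mpr hT'.2

theorem measurableSet_longSpine (hr : 1 ≤ r) : MeasurableSet (longSpine r) := by
  rw [longSpine_eq_biUnion hr]
  exact MeasurableSet.biUnion (countable_spined r) fun T _ => measurableSet_cylinder T hr

/-- The trees with a spine of length `r` are the disjoint union of countably many cylinders around
one-sided trees of height `r`, whose masses sum to one. All other cylinders of radius `r` are then
null. -/
theorem HasBallMasses.longSpine_eq_one {τ : Measure PlaneTree} (h : HasBallMasses p q τ)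
    (hp : 0 < p) (hpq : p < q) (h1 : p + q = 1) (hr : 1 ≤ r) : τ (longSpine r) = 1 := by
  rw [longSpine_eq_biUnion hr, measure_biUnion (countable_spined r) (pairwiseDisjoint_cylinder r)
    fun T _ => measurableSet_cylinder T hr, ← tsum_ballMass_eq_one hp hpq h1 hr]
  rw [← tsum_subtype (spined r) fun T => ballMass p q r (T.ballSize r) (T.level r).ncard]
  exact tsum_congr fun T => h r T.1 hr T.2

theorem HasBallMasses.compl_longSpine {τ : Measure PlaneTree} [IsProbabilityMeasure τ]
    (h : HasBallMasses p q τ) (hp : 0 < p) (hpq : p < q) (h1 : p + q = 1) (hr : 1 ≤ r) :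
    τ (longSpine r)ᶜ = 0 := by
  rw [prob_compl_eq_zero_iff (measurableSet_longSpine hr)]
  exact h.longSpine_eq_one hp hpq h1 hr

theorem HasBallMasses.compl_infiniteOneSided {τ : Measure PlaneTree} [IsProbabilityMeasure τ]
    (h : HasBallMasses p q τ) (hp : 0 < p) (hpq : p < q) (h1 : p + q = 1) :
    τ infiniteOneSidedᶜ = 0 := by
  refine measure_mono_null (t := ⋃ r : ℕ, (longSpine (r + 1))ᶜ) (fun T hT => ?_)
    (measure_iUnion_null fun r => h.compl_longSpine hp hpq h1 (by omega))
  rw [Set.mem_compl_iff, mem_infiniteOneSided_iff, not_forall] at hT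
  obtain ⟨r, hr⟩ := hT
  exact Set.mem_iUnion.mpr ⟨r, fun hm => hr (replicate_mem_of_le (Nat.le_succ r) hm)⟩

/-- A probability measure is determined by the masses of the balls around one-sided trees. -/
theorem HasBallMasses.eq {σ τ : Measure PlaneTree} [IsProbabilityMeasure σ]
    [IsProbabilityMeasure τ] (hσ : HasBallMasses p q σ) (hτ : HasBallMasses p q τ)
    (hp : 0 < p) (hpq : p < q) (h1 : p + q = 1) : σ = τ := by
  refine ext_of_generate_finite cylinders borel_eq_generateFrom_cylinders isPiSystem_cylinders
    ?_ (by simp)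
  rintro _ ⟨T, r, hr, rfl⟩
  by_cases h0 : List.replicate r 0 ∈ T.verts
  · have hT := truncate_mem_spined hr h0
    rw [cylinder_congr (T' := T) (T := T.truncate r hr) (rootBall_truncate T hr le_rfl).symm,
      hσ r _ hr hT, hτ r _ hr hT]
  · have hsub : T.cylinder r ⊆ (longSpine r)ᶜ := fun T' hT' hm =>
      h0 ((mem_verts_iff_of_rootBall_eq hT' List.length_replicate.le).mp hm)
    rw [measure_mono_null hsub (hσ.compl_longSpine hp hpq h1 hr),
      measure_mono_null hsub (hτ.compl_longSpine hp hpq h1 hr)]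

end Uniqueness

/-! ### Tightness and weak convergence -/

section Convergence

variable {T : PlaneTree} {r : ℕ} {μ p q : ℝ}

/-- A single probability measure charges only finitely many balls, up to a small error. -/
theorem exists_finite_measure_rootBall_notMem (ν : Measure PlaneTree) [IsProbabilityMeasure ν]
    (hr : 1 ≤ r) {δ : ℝ≥0∞} (hδ : 0 < δ) :
    ∃ A : Set (Set (List ℕ)), A.Finite ∧ ν {T | T.rootBall r ∉ A} ≤ δ := by
  obtain ⟨K, hK, hνK⟩ := isTightMeasureSet_iff_exists_isCompact_measure_compl_le.mp
    (isTightMeasureSet_singleton (μ := ν)) δ hδ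
  have hsub : {T : PlaneTree | T.rootBall r ∉ (fun T : PlaneTree => T.rootBall r) '' K} ⊆ Kᶜ :=
    fun T hT hTK => hT ⟨T, hTK, rfl⟩
  exact ⟨_, hK.finite_image_rootBall hr, (measure_mono hsub).trans (hνK ν rfl)⟩

/-- The finite-size measures uniformly charge only finitely many balls, up to a small error. -/
theorem exists_finite_finiteSizeMeasure_rootBall_notMem (hp : 0 < p) (hpq : p < q)
    (h1 : p + q = 1) (hμ : Real.exp (-μ) = p⁻¹) (hr : 1 ≤ r) {δ : ℝ≥0∞} (hδ : 0 < δ) :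
    ∃ A : Set (Set (List ℕ)), A.Finite ∧
      ∀ N, finiteSizeMeasure μ (N + 1) {T | T.rootBall r ∉ A} ≤ δ := by
  have hprob : ∀ N, IsProbabilityMeasure (finiteSizeMeasure μ (N + 1)) := fun N =>
    isProbabilityMeasure_finiteSizeMeasure μ (Nat.le_add_left 1 N)
  choose A hA hAδ using fun N =>
    exists_finite_measure_rootBall_notMem (finiteSizeMeasure μ (N + 1)) hr hδ
  -- The limiting masses sum to one, so finitely many cylinders carry more than `1 - δ` in the
  -- limit, hence for all large `N`. The remaining finitely many `N` are handled by the sets `A N`.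
  obtain ⟨F, hF⟩ : ∃ F : Finset (spined r), 1 - δ <
      ∑ T ∈ F, ballMass p q r (T.1.ballSize r) (T.1.level r).ncard := by
    have h := tsum_ballMass_eq_one hp hpq h1 hr
    rw [← tsum_subtype, ENNReal.tsum_eq_iSup_sum] at h
    have hlt : 1 - δ < 1 := ENNReal.sub_lt_self ENNReal.one_ne_top one_ne_zero hδ.ne'
    rw [← h] at hlt
    simpa only [h] using lt_iSup_iff.mp hlt
  have hdisj : (F : Set (spined r)).PairwiseDisjoint fun T => T.1.cylinder r :=
    fun T _ T' _ hne => pairwiseDisjoint_cylinder r T.2 T'.2 (Subtype.coe_ne_coe.mpr hne)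
  have hmeas : ∀ T ∈ F, MeasurableSet (T.1.cylinder r) := fun T _ =>
    measurableSet_cylinder T.1 hr
  have hlim : Tendsto (fun N => finiteSizeMeasure μ (N + 1) (⋃ T ∈ F, T.1.cylinder r)) atTop
      (𝓝 (∑ T ∈ F, ballMass p q r (T.1.ballSize r) (T.1.level r).ncard)) := by
    simp_rw [measure_biUnion_finset hdisj hmeas]
    exact tendsto_finsetSum F fun T _ => (tendsto_finiteSizeMeasure_cylinder hp hpq h1 hμ hr
      T.2.2 (measurableSet_cylinder T.1 hr)).comp (tendsto_add_atTop_nat 1)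
  obtain ⟨N₀, hN₀⟩ := eventually_atTop.mp (hlim.eventually_const_lt hF)
  refine ⟨(fun T : spined r => T.1.rootBall r) '' F ∪ ⋃ N ∈ Finset.range N₀, A N,
    (F.finite_toSet.image _).union (Set.Finite.biUnion (Finset.finite_toSet _) fun N _ => hA N),
    fun N => ?_⟩
  rcases lt_or_ge N N₀ with hN | hN
  · have hsub : {T : PlaneTree | T.rootBall r ∉ (fun T : spined r => T.1.rootBall r) '' F ∪
        ⋃ N ∈ Finset.range N₀, A N} ⊆ {T | T.rootBall r ∉ A N} := fun T hT hm =>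
      hT (Or.inr (Set.mem_biUnion (Finset.mem_coe.mpr (Finset.mem_range.mpr hN)) hm))
    exact (measure_mono hsub).trans (hAδ N)
  · have hsub : {T : PlaneTree | T.rootBall r ∉ (fun T : spined r => T.1.rootBall r) '' F ∪
        ⋃ N ∈ Finset.range N₀, A N} ⊆ (⋃ T ∈ F, T.1.cylinder r)ᶜ := fun T hT hm => by
      obtain ⟨T', hT', h⟩ := Set.mem_iUnion₂.mp hm
      exact hT (Or.inl ⟨T', hT', (mem_cylinder.mp h).symm⟩)
    refine (measure_mono hsub).trans ?_
    rw [prob_compl_eq_one_sub (Finset.measurableSet_biUnion F hmeas)]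
    exact tsub_le_iff_tsub_le.mp (hN₀ N hN).le

theorem isTightMeasureSet_finiteSizeMeasure (hp : 0 < p) (hpq : p < q)
    (h1 : p + q = 1) (hμ : Real.exp (-μ) = p⁻¹) :
    IsTightMeasureSet (Set.range fun N => finiteSizeMeasure μ (N + 1)) := by
  rw [isTightMeasureSet_iff_exists_isCompact_measure_compl_le]
  intro ε hε
  -- One error per radius, summable to less than `ε`, for a union bound over all radii.
  obtain ⟨δ, hδ, hδε⟩ := ENNReal.exists_pos_sum_of_countable' hε.ne' ℕ
  choose A hA hAδ using fun n =>
    exists_finite_finiteSizeMeasure_rootBall_notMem hp hpq h1 hμ (Nat.le_add_left 1 n) (hδ n)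
  refine ⟨_, isCompact_setOf_rootBall_mem hA, ?_⟩
  rintro _ ⟨N, rfl⟩
  have hcompl : {T : PlaneTree | ∀ n, T.rootBall (n + 1) ∈ A n}ᶜ =
      ⋃ n, {T : PlaneTree | T.rootBall (n + 1) ∉ A n} := by
    ext T
    simp
  calc finiteSizeMeasure μ (N + 1) {T : PlaneTree | ∀ n, T.rootBall (n + 1) ∈ A n}ᶜ
      ≤ ∑' n, finiteSizeMeasure μ (N + 1) {T : PlaneTree | T.rootBall (n + 1) ∉ A n} := by
        rw [hcompl]
        exact measure_iUnion_le _
    _ ≤ ∑' n, δ n := ENNReal.tsum_le_tsum fun n => hAδ n N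
    _ ≤ ε := hδε.le

/-- The finite-size measures, as probability measures. -/
noncomputable def finiteSizeProbability (μ : ℝ) (N : ℕ) : ProbabilityMeasure PlaneTree :=
  ⟨finiteSizeMeasure μ (N + 1), isProbabilityMeasure_finiteSizeMeasure μ (Nat.le_add_left 1 N)⟩

theorem hasBallMasses_of_tendsto (hp : 0 < p) (hpq : p < q) (h1 : p + q = 1)
    (hμ : Real.exp (-μ) = p⁻¹) {l : Filter ℕ} [l.NeBot] (hl : l ≤ atTop)
    {τ : ProbabilityMeasure PlaneTree} (hτ : Tendsto (finiteSizeProbability μ) l (𝓝 τ)) :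
    HasBallMasses p q (τ : Measure PlaneTree) := by
  intro r T hr hT
  have hfr : (τ : Measure PlaneTree) (frontier (T.cylinder r)) = 0 := by
    rw [(isClopen_cylinder T hr).frontier_eq, measure_empty]
  refine tendsto_nhds_unique
    (ProbabilityMeasure.tendsto_measure_of_null_frontier_of_tendsto' hτ hfr) ?_
  exact ((tendsto_finiteSizeMeasure_cylinder hp hpq h1 hμ hr hT.2
    (measurableSet_cylinder T hr)).comp (tendsto_add_atTop_nat 1)).mono_left hl

/-- The finite-size measures converge weakly. -/
theorem exists_tendsto_finiteSizeProbability (hp : 0 < p) (hpq : p < q) (h1 : p + q = 1)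
    (hμ : Real.exp (-μ) = p⁻¹) : ∃ τ : ProbabilityMeasure PlaneTree,
      HasBallMasses p q (τ : Measure PlaneTree) ∧
        Tendsto (finiteSizeProbability μ) atTop (𝓝 τ) := by
  have hcompact : IsCompact (closure (Set.range (finiteSizeProbability μ))) := by
    refine isCompact_closure_of_isTightMeasureSet ?_
    convert isTightMeasureSet_finiteSizeMeasure hp hpq h1 hμ using 1
    ext ν
    constructor
    · rintro ⟨_, ⟨N, rfl⟩, rfl⟩
      exact ⟨N, rfl⟩
    · rintro ⟨N, rfl⟩
      exact ⟨_, ⟨N, rfl⟩, rfl⟩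
  have hlim : ∀ U : Ultrafilter ℕ, (U : Filter ℕ) ≤ atTop → ∃ τ : ProbabilityMeasure PlaneTree,
      HasBallMasses p q (τ : Measure PlaneTree) ∧
        Tendsto (finiteSizeProbability μ) U (𝓝 τ) := fun U hU => by
    obtain ⟨τ, -, hτ⟩ := hcompact.ultrafilter_le_nhds (U.map (finiteSizeProbability μ))
      (le_principal_iff.mpr (Ultrafilter.mem_map.mpr
        (Filter.univ_mem' fun N => subset_closure ⟨N, rfl⟩)))
    exact ⟨τ, hasBallMasses_of_tendsto hp hpq h1 hμ hU hτ, hτ⟩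
  -- The limit along one ultrafilter is the candidate. The limit along any other has the same ball
  -- masses and so is the same measure, which upgrades compactness to convergence.
  obtain ⟨τ, hτ, -⟩ := hlim (Ultrafilter.of atTop) (Ultrafilter.of_le atTop)
  refine ⟨τ, hτ, (tendsto_iff_ultrafilter _ _ _).mpr fun U hU => ?_⟩
  obtain ⟨σ, hσ, hσU⟩ := hlim U hU
  have heq : (σ : Measure PlaneTree) = τ := hσ.eq hτ hp hpq h1
  obtain rfl : σ = τ := Subtype.ext heq
  exact hσU

theorem one_le_ballSize (T : PlaneTree) (hr : 1 ≤ r) : 1 ≤ T.ballSize r := by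
  induction r, hr using Nat.le_induction with
  | base => exact (ballSize_one T).ge
  | succ r _ ih => exact (ballSize_succ T r).symm ▸ ih.trans (Nat.le_add_right _ _)

/-- With `X(g_c) = p` and `g_c = pq`, the factor `g_c^{-(K-1)} X(g_c)^{K-1}` equals `q^{-(K-1)}`,
leaving `g_c^{n-1}`. -/
theorem ofReal_ballWeight (hp : 0 < p) (hpq : p < q) (hμ : Real.exp μ = p)
    (hc : criticalCoupling μ = p * q) (hX : treeGF (criticalCoupling μ) = p) {n K : ℕ}
    (hr : 1 ≤ r) (hn : 1 ≤ n) (hK : 1 ≤ K) :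
    ENNReal.ofReal (ballWeight μ r n K) = ballMass p q r n K := by
  have hq : 0 < q := hp.trans hpq
  obtain ⟨r, rfl⟩ := Nat.exists_eq_add_of_le' hr
  obtain ⟨n, rfl⟩ := Nat.exists_eq_add_of_le' hn
  obtain ⟨K, rfl⟩ := Nat.exists_eq_add_of_le' hK
  have hexp : Real.exp (-μ * (((r + 1 : ℕ) : ℝ) - 1)) = p⁻¹ ^ r := by
    rw [Nat.cast_add, Nat.cast_one, add_sub_cancel_right, mul_comm, Real.exp_nat_mul,
      Real.exp_neg, hμ]
  have hpow : (p * q) ^ (((n + 1 : ℕ) : ℤ) - ((K + 1 : ℕ) : ℤ)) * p ^ (((K + 1 : ℕ) : ℤ) - 1) =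
      (p * q) ^ n * q⁻¹ ^ K := by
    have e1 : ((n + 1 : ℕ) : ℤ) - ((K + 1 : ℕ) : ℤ) = (n : ℤ) - (K : ℤ) := by push_cast; ring
    have e2 : ((K + 1 : ℕ) : ℤ) - 1 = (K : ℤ) := by push_cast; ring
    rw [e1, e2, zpow_sub₀ (by positivity), zpow_natCast, zpow_natCast, zpow_natCast, mul_pow p q K,
      inv_pow]
    field_simp
  rw [ballWeight, hX, hc, hexp, mul_assoc, hpow, ballMass, Nat.add_sub_cancel, Nat.add_sub_cancel,
    Nat.add_sub_cancel, mul_assoc, ENNReal.ofReal_mul (by positivity),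
    ENNReal.ofReal_mul (by positivity), ENNReal.ofReal_pow (by positivity),
    ENNReal.ofReal_pow (by positivity), ENNReal.ofReal_pow (by positivity)]

theorem hasBallWeights_iff (hp : 0 < p) (hpq : p < q) (hμ : Real.exp μ = p)
    (hc : criticalCoupling μ = p * q) (hX : treeGF (criticalCoupling μ) = p)
    (τ : Measure PlaneTree) : HasBallWeights μ τ ↔ HasBallMasses p q τ := by
  have hK : ∀ {r : ℕ} {T : PlaneTree}, T ∈ spined r → 1 ≤ (T.level r).ncard := fun {r T} hT =>
    (Set.ncard_pos (T.level_finite r)).mpr ⟨_, replicate_mem_level hT.2⟩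
  constructor
  · intro h r T hr hT
    have hT' := (mem_spined_iff r).mp hT
    rw [← closedBall_eq_cylinder T hr, ← ofReal_ballWeight hp hpq hμ hc hX hr
      (T.one_le_ballSize hr) (hK hT)]
    exact h T r _ _ (spined_isFinite hT) hT'.1 hT'.2 hT.1.size_eq
      (T.level_finite r).cast_ncard_eq.symm
  · intro h T r n K _ hone hheight hsize hlevel
    have hT := (mem_spined_iff r).mpr ⟨hone, hheight⟩
    -- The root edge gives every tree height at least one.
    have hr : 1 ≤ r := hT.1 [0] ((T.root_degree_one 0).mpr rfl)
    obtain rfl : n = T.ballSize r := by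
      rw [hT.1.size_eq] at hsize
      exact_mod_cast hsize.symm
    obtain rfl : K = (T.level r).ncard := by rw [Set.ncard_def, hlevel, ENat.toNat_natCast]
    rw [closedBall_eq_cylinder T hr, h r T hr hT, ofReal_ballWeight hp hpq hμ hc hX hr
      (T.one_le_ballSize hr) (hK hT)]

end Convergence

end PlaneTree

theorem mainTheorem2 (μ : ℝ) (hμ : μ < -Real.log 2) :
    (∀ N : ℕ, 1 ≤ N → IsProbabilityMeasure (PlaneTree.finiteSizeMeasure μ N)) ∧
    Summable (fun T : {T : PlaneTree // T.IsFinite} =>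
      PlaneTree.criticalCoupling μ ^ T.1.size.toNat) ∧
    ∃ τ : Measure PlaneTree, IsProbabilityMeasure τ ∧
      (∀ F : PlaneTree →ᵇ ℝ,
        Tendsto (fun N : ℕ => ∫ T, F T ∂(PlaneTree.finiteSizeMeasure μ N)) atTop
          (𝓝 (∫ T, F T ∂τ))) ∧
      τ PlaneTree.infiniteOneSidedᶜ = 0 ∧
      PlaneTree.HasBallWeights μ τ ∧
      (∀ σ : Measure PlaneTree, IsProbabilityMeasure σ → PlaneTree.HasBallWeights μ σ → σ = τ) := by
  have hp : 0 < Real.exp μ := Real.exp_pos μ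
  have hlt : Real.exp μ < 1 / 2 := by
    rw [← Real.lt_log_iff_exp_lt (by norm_num), one_div, Real.log_inv]
    exact hμ
  have hpq : Real.exp μ < 1 - Real.exp μ := by linarith
  have h1 : Real.exp μ + (1 - Real.exp μ) = 1 := by ring
  have hsum := PlaneTree.hasSum_treeGF hp hpq h1
  have hX : PlaneTree.treeGF (PlaneTree.criticalCoupling μ) = Real.exp μ := hsum.tsum_eq
  have hiff := PlaneTree.hasBallWeights_iff hp hpq rfl rfl hX
  obtain ⟨τ, hτ, hlim⟩ :=
    PlaneTree.exists_tendsto_finiteSizeProbability hp hpq h1 (Real.exp_neg μ)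
  refine ⟨fun N hN => PlaneTree.isProbabilityMeasure_finiteSizeMeasure μ hN, hsum.summable,
    τ, inferInstance, fun F => ?_, hτ.compl_infiniteOneSided hp hpq h1, (hiff τ).mpr hτ,
    fun σ hσ hw => ((hiff σ).mp hw).eq hτ hp hpq h1⟩
  -- No tree has size zero, so the measure for `N = 0` is zero; the probability measures start at `N
  -- = 1`.
  rw [← tendsto_add_atTop_iff_nat 1]
  exact (ProbabilityMeasure.tendsto_iff_forall_integral_tendsto.mp hlim) F
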